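/- Let $\pi$ be a smooth, strictly positive, bounded probability density on $\mathbb R^d$ such that $|\nabla\log\pi(x)|\to\infty$ as $|x|\to\infty$ and, for some $0<\beta<1$, $\liminf_{|x|\to\infty}\big((1-\beta)|\nabla\log\pi(x)|^2+\Delta\log\pi(x)\big)>0$. Let $\gamma:\mathbb R^d\to\mathbb R^d$ be a smooth bounded vector field with $\nabla\cdot(\gamma\pi)=0$, and let $\alpha\in\mathbb R$. Write $L^2_0(\pi)$ for the real Hilbert space of mean-zero functions in $L^2(\pi)$, with inner product $\langle\cdot,\cdot\rangle_\pi$. Let $\nabla:\mathcal H^1\to L^2(\pi;\mathbb R^d)$ be the closure of the gradient on the centred test functions $\varphi-\pi(\varphi)$, $\varphi\in C_c^\infty(\mathbb R^d)$. Let $\mathcal S=\nabla\log\pi\cdot\nabla+\Delta$ be the self-adjoint (Friedrichs) realization on $L^2_0(\pi)$: its domain consists of the $u\in\mathcal H^1$ for which $\nabla\log\pi\cdot\nabla u+\Delta u$, taken in the weak sense with respect to $\pi$, is some $h\in L^2_0(\pi)$, that is, $\int u\,(\nabla\log\pi\cdot\nabla\varphi+\Delta\varphi)\,d\pi=\int h\varphi\,d\pi$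 for all $\varphi\in C_c^\infty(\mathbb R^d)$, and then $\mathcal Su=h$. Let $\mathcal A=\gamma\cdot\nabla$ with domain $\mathcal H^1$, and $\mathcal L=\mathcal S+\alpha\mathcal A$ with domain $\mathcal D(\mathcal S)$. Then $\mathcal A$ maps $\mathcal H^1$ into $L^2_0(\pi)$ and its adjoint $\mathcal A^*$ in $L^2_0(\pi)$ extends $-\mathcal A$; the operators $-\mathcal L$ and $-\mathcal S$ have bounded everywhere-defined inverses on $L^2_0(\pi)$; and, with $[R]^S=\tfrac12(R+R^*)$ the symmetric part of a bounded operator $R$, $$\big[(-\mathcal L)^{-1}\big]^S=\big[-\mathcal S+\alpha^2\mathcal A^*(-\mathcal S)^{-1}\mathcal A\big]^{-1},$$ where the operator in brackets on the right is taken on its natural domain and is bijective onto $L^2_0(\pi)$. For $f\in L^2_0(\pi)$ define the asymptotic variance $\sigma_f^2(\alpha)=2\int|\nabla\phi|^2\,d\pi$, where $\phi\in\mathcal D(\mathcal S)$ is the unique solution of the Poisson equation $-\mathcal L\phi=f$. Then for all $f\in L^2_0(\pi)$ $$\sigma_f^2(\alpha)=2\langle f,(-\mathcal L)^{-1}f\rangle_\pi\le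 2\langle f,(-\mathcal S)^{-1}f\rangle_\pi=\sigma_f^2(0).$$ -/

import Mathlib

open MeasureTheory
open scoped ContDiff

noncomputable section

namespace NonreversibleLangevin

/-- A smooth, strictly positive probability density on `ℝ^d`. -/
structure TargetDensity (d : ℕ) where
  toFun : EuclideanSpace ℝ (Fin d) → ℝ
  smooth : ContDiff ℝ ∞ toFun
  pos : ∀ x, 0 < toFun x
  integral_eq_one : ∫ x, toFun x = 1

/-- `C_c^∞(ℝ^d)`. -/
def IsTest {d : ℕ} (φ : EuclideanSpace ℝ (Fin d) → ℝ) : Prop :=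
  ContDiff ℝ ∞ φ ∧ HasCompactSupport φ

section Target

variable {d : ℕ} (ρ : TargetDensity d)

/-- The probability measure `π(dx) = π(x) dx`. -/
def TargetDensity.measure : Measure (EuclideanSpace ℝ (Fin d)) :=
  volume.withDensity (fun x => ENNReal.ofReal (ρ.toFun x))

instance TargetDensity.isProbabilityMeasure : IsProbabilityMeasure ρ.measure := by
  refine ⟨?_⟩
  have hint : Integrable ρ.toFun volume := by
    by_contra h
    have h1 := ρ.integral_eq_one
    rw [integral_undef h] at h1
    exact zero_ne_one h1
  rw [TargetDensity.measure, withDensity_apply _ MeasurableSet.univ, Measure.restrict_univ,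
    ← ofReal_integral_eq_lintegral_ofReal hint (Filter.Eventually.of_forall fun x => (ρ.pos x).le),
    ρ.integral_eq_one, ENNReal.ofReal_one]

/-- `log π`. -/
def TargetDensity.logDensity : EuclideanSpace ℝ (Fin d) → ℝ := fun x => Real.log (ρ.toFun x)

/-- The density is bounded and, for some `0 < β < 1`,
`liminf_{|x| → ∞} ((1 - β) |∇ log π(x)|² + Δ log π(x)) > 0`. -/
def TargetDensity.DriftCondition : Prop :=
  (∃ C : ℝ, ∀ x, ρ.toFun x ≤ C) ∧
  ∃ β : ℝ, 0 < β ∧ β < 1 ∧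
    0 < Filter.liminf
      (fun x => (((1 - β) * ‖gradient ρ.logDensity x‖ ^ 2
        + Laplacian.laplacian ρ.logDensity x : ℝ) : EReal))
      (Filter.cocompact (EuclideanSpace ℝ (Fin d)))

/-- `|∇ log π(x)| → ∞` as `|x| → ∞`. -/
def TargetDensity.GradLogToInfinity : Prop :=
  Filter.Tendsto (fun x => ‖gradient ρ.logDensity x‖)
    (Filter.cocompact (EuclideanSpace ℝ (Fin d))) Filter.atTop

/-- A smooth bounded vector field `γ` with `∇ · (γ π) = 0`. -/
structure IsPerturbation
    (γ : EuclideanSpace ℝ (Fin d) → EuclideanSpace ℝ (Fin d)) : Prop where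
  smooth : ContDiff ℝ ∞ γ
  bounded : ∃ C : ℝ, ∀ x, ‖γ x‖ ≤ C
  div_free : ∀ x, ∑ i : Fin d,
    fderiv ℝ (fun y => γ y i * ρ.toFun y) x (EuclideanSpace.single i 1) = 0

/-- `L²₀(π)`: the real square integrable functions with zero mean, with the `L²(π)` inner
product. -/
def L20 : Submodule ℝ (Lp ℝ 2 ρ.measure) where
  carrier := {f | ∫ x, f x ∂ρ.measure = 0}
  zero_mem' := by
    rw [Set.mem_ofPred_eq, integral_congr_ae (Lp.coeFn_zero ℝ 2 ρ.measure)]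
    simp
  add_mem' := by
    intro f g hf hg
    rw [Set.mem_ofPred_eq] at *
    rw [integral_congr_ae (Lp.coeFn_add f g)]
    simp only [Pi.add_apply]
    rw [integral_add ((Lp.memLp f).integrable (by norm_num))
      ((Lp.memLp g).integrable (by norm_num)), hf, hg, add_zero]
  smul_mem' := by
    intro c f hf
    rw [Set.mem_ofPred_eq] at *
    rw [integral_congr_ae (Lp.coeFn_smul c f)]
    simp only [Pi.smul_apply, integral_smul, hf, smul_zero]

theorem mem_L20 (f : Lp ℝ 2 ρ.measure) : f ∈ L20 ρ ↔ ∫ x, f x ∂ρ.measure = 0 := Iff.rfl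

instance : CompleteSpace (L20 ρ) := by
  have h : (L20 ρ : Set (Lp ℝ 2 ρ.measure)) =
      {f | inner ℝ (indicatorConstLp 2 MeasurableSet.univ
        (measure_ne_top ρ.measure Set.univ) (1 : ℝ)) f = 0} := by
    ext f
    rw [SetLike.mem_coe, mem_L20, Set.mem_ofPred_eq, L2.inner_indicatorConstLp_one]
    simp
  have hc : IsClosed (L20 ρ : Set (Lp ℝ 2 ρ.measure)) := by
    rw [h]
    exact isClosed_eq (by fun_prop) continuous_const
  exact hc.completeSpace_coe

/-- The pairs `(φ - π(φ), ∇φ)` for test functions `φ`. -/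
def testGradGraph : Submodule ℝ (L20 ρ × Lp (EuclideanSpace ℝ (Fin d)) 2 ρ.measure) where
  carrier := {p | ∃ φ : EuclideanSpace ℝ (Fin d) → ℝ, IsTest φ ∧
    ((p.1 : Lp ℝ 2 ρ.measure) =ᵐ[ρ.measure] fun x => φ x - ∫ y, φ y ∂ρ.measure) ∧
    (p.2 =ᵐ[ρ.measure] fun x => gradient φ x)}
  zero_mem' := by
    refine ⟨0, ⟨contDiff_zero_fun, HasCompactSupport.zero⟩, ?_, ?_⟩
    · filter_upwards [Lp.coeFn_zero ℝ 2 ρ.measure] with x hx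
      simp
    · filter_upwards [Lp.coeFn_zero (EuclideanSpace ℝ (Fin d)) 2 ρ.measure] with x hx
      have : gradient (0 : EuclideanSpace ℝ (Fin d) → ℝ) x = 0 := by
        simp [gradient]
      simp [this]
  add_mem' := by
    rintro p q ⟨φ, hφ, h1, h2⟩ ⟨ψ, hψ, h3, h4⟩
    refine ⟨φ + ψ, ⟨hφ.1.add hψ.1, hφ.2.add hψ.2⟩, ?_, ?_⟩
    · have e : ∫ y, (φ + ψ) y ∂ρ.measure = ∫ y, φ y ∂ρ.measure + ∫ y, ψ y ∂ρ.measure := by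
        simp only [Pi.add_apply]
        exact integral_add (hφ.1.continuous.integrable_of_hasCompactSupport hφ.2)
          (hψ.1.continuous.integrable_of_hasCompactSupport hψ.2)
      filter_upwards [h1, h3, Lp.coeFn_add (p.1 : Lp ℝ 2 ρ.measure) (q.1 : Lp ℝ 2 ρ.measure)]
        with x a b c
      rw [e]
      change ((p.1 : Lp ℝ 2 ρ.measure) + (q.1 : Lp ℝ 2 ρ.measure) : Lp ℝ 2 ρ.measure) x = _
      rw [c, Pi.add_apply, a, b, Pi.add_apply]
      ring
    · filter_upwards [h2, h4, Lp.coeFn_add p.2 q.2] with x a b c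
      rw [Prod.snd_add, c, Pi.add_apply, a, b]
      simp only [gradient]
      rw [fderiv_add (hφ.1.differentiable (by simp) x) (hψ.1.differentiable (by simp) x), map_add]
  smul_mem' := by
    rintro c p ⟨φ, hφ, h1, h2⟩
    refine ⟨c • φ, ⟨hφ.1.const_smul c, hφ.2.smul_left (f := fun _ => c)⟩, ?_, ?_⟩
    · filter_upwards [h1, Lp.coeFn_smul c (p.1 : Lp ℝ 2 ρ.measure)] with x a b
      change (c • (p.1 : Lp ℝ 2 ρ.measure) : Lp ℝ 2 ρ.measure) x = _
      rw [b, Pi.smul_apply, a]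
      simp only [Pi.smul_apply, smul_eq_mul, integral_const_mul]
      ring
    · filter_upwards [h2, Lp.coeFn_smul c p.2] with x a b
      rw [Prod.smul_snd, b, Pi.smul_apply, a]
      simp only [gradient]
      rw [fderiv_const_smul (hφ.1.differentiable (by simp) x), map_smul]

/-- The graph of the closed gradient `∇ : ℋ¹ ⊆ L²₀(π) → L²(π; ℝ^d)`. Its domain `ℋ¹` is the
completion of the (centred) test functions in the norm `‖φ‖₁² = ⟨φ, (-𝒮)φ⟩ = ‖∇φ‖²`
together with the `L²` norm. -/
def gradGraph : Submodule ℝ (L20 ρ × Lp (EuclideanSpace ℝ (Fin d)) 2 ρ.measure) :=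
  (testGradGraph ρ).topologicalClosure

theorem TargetDensity.smooth_log : ContDiff ℝ ∞ ρ.logDensity :=
  ρ.smooth.log fun x => (ρ.pos x).ne'

theorem TargetDensity.integral_eq (g : EuclideanSpace ℝ (Fin d) → ℝ) :
    ∫ x, g x ∂ρ.measure = ∫ x, ρ.toFun x * g x := by
  rw [TargetDensity.measure, integral_withDensity_eq_integral_toReal_smul
    (ρ.smooth.continuous.measurable.ennreal_ofReal) (by simp)]
  simp [ENNReal.toReal_ofReal (ρ.pos _).le]

theorem continuous_gradient {φ : EuclideanSpace ℝ (Fin d) → ℝ} (hφ : ContDiff ℝ ∞ φ) :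
    Continuous (gradient φ) :=
  (InnerProductSpace.toDual ℝ (EuclideanSpace ℝ (Fin d))).symm.continuous.comp
    (hφ.continuous_fderiv (by simp))

theorem gradient_coord (φ : EuclideanSpace ℝ (Fin d) → ℝ) (x : EuclideanSpace ℝ (Fin d))
    (i : Fin d) : gradient φ x i = fderiv ℝ φ x (EuclideanSpace.single i 1) := by
  rw [← inner_gradient_left, EuclideanSpace.inner_single_right]
  simp

/-- The weak form of `∂ᵢu = gᵢ`, tested against `ψ π`. -/
theorem gradGraph_weak {p : L20 ρ × Lp (EuclideanSpace ℝ (Fin d)) 2 ρ.measure}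
    (hp : p ∈ gradGraph ρ) {ψ : EuclideanSpace ℝ (Fin d) → ℝ} (hψ : IsTest ψ) (i : Fin d) :
    ∫ x, ψ x * p.2 x i ∂ρ.measure =
      -∫ x, (fderiv ℝ ψ x (EuclideanSpace.single i 1)
        + ψ x * fderiv ℝ ρ.logDensity x (EuclideanSpace.single i 1))
        * (p.1 : Lp ℝ 2 ρ.measure) x ∂ρ.measure := by
  set e : EuclideanSpace ℝ (Fin d) := EuclideanSpace.single i 1 with he
  have hψ' : Continuous fun x => fderiv ℝ ψ x e :=
    (hψ.1.continuous_fderiv (by simp)).clm_apply continuous_const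
  have hl : Continuous fun x => fderiv ℝ ρ.logDensity x e :=
    (ρ.smooth_log.continuous_fderiv (by simp)).clm_apply continuous_const
  have hk : MemLp (fun x => fderiv ℝ ψ x e + ψ x * fderiv ℝ ρ.logDensity x e) 2 ρ.measure :=
    (hψ'.add (hψ.1.continuous.mul hl)).memLp_of_hasCompactSupport
      ((hψ.2.fderiv_apply ℝ e).add hψ.2.mul_right)
  have hm : MemLp (fun x => ψ x • e) 2 ρ.measure :=
    (hψ.1.continuous.smul continuous_const).memLp_of_hasCompactSupport hψ.2.smul_right
  have e1 : ∀ q : Lp (EuclideanSpace ℝ (Fin d)) 2 ρ.measure,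
      ∫ x, ψ x * q x i ∂ρ.measure = inner ℝ (hm.toLp _) q := by
    intro q
    rw [L2.inner_def]
    refine integral_congr_ae ?_
    filter_upwards [hm.coeFn_toLp] with x hx
    rw [hx, inner_smul_left, he, EuclideanSpace.inner_single_left]
    simp
  have e2 : ∀ q : Lp ℝ 2 ρ.measure,
      ∫ x, (fderiv ℝ ψ x e + ψ x * fderiv ℝ ρ.logDensity x e) * q x ∂ρ.measure
        = inner ℝ (hk.toLp _) q := by
    intro q
    rw [L2.inner_def]
    refine integral_congr_ae ?_
    filter_upwards [hk.coeFn_toLp] with x hx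
    rw [hx]
    simp [mul_comm]
  have hclosed : IsClosed {p : L20 ρ × Lp (EuclideanSpace ℝ (Fin d)) 2 ρ.measure |
      ∫ x, ψ x * p.2 x i ∂ρ.measure =
      -∫ x, (fderiv ℝ ψ x e + ψ x * fderiv ℝ ρ.logDensity x e)
        * (p.1 : Lp ℝ 2 ρ.measure) x ∂ρ.measure} := by
    simp only [e1, e2]
    exact isClosed_eq (by fun_prop) (by fun_prop)
  suffices hsub : (testGradGraph ρ : Set (L20 ρ × Lp (EuclideanSpace ℝ (Fin d)) 2 ρ.measure)) ⊆
      {p | ∫ x, ψ x * p.2 x i ∂ρ.measure =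
      -∫ x, (fderiv ℝ ψ x e + ψ x * fderiv ℝ ρ.logDensity x e)
        * (p.1 : Lp ℝ 2 ρ.measure) x ∂ρ.measure} from
    closure_minimal hsub hclosed hp
  rintro q ⟨φ, hφ, h1, h2⟩
  rw [Set.mem_ofPred_eq]
  set c := ∫ y, φ y ∂ρ.measure
  have hd : ∀ x, fderiv ℝ (fun y => φ y - c) x = fderiv ℝ φ x := fun x => fderiv_sub_const c
  have hg : ∀ x, fderiv ℝ (fun y => ρ.toFun y * ψ y) x e
      = ρ.toFun x * (fderiv ℝ ψ x e + ψ x * fderiv ℝ ρ.logDensity x e) := by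
    intro x
    have hρ : DifferentiableAt ℝ ρ.toFun x := ρ.smooth.differentiable (by simp) x
    rw [fderiv_fun_mul hρ (hψ.1.differentiable (by simp) x)]
    unfold TargetDensity.logDensity
    rw [fderiv.log hρ (ρ.pos x).ne']
    have := (ρ.pos x).ne'
    simp only [add_apply, smul_apply, smul_eq_mul]
    field_simp
  have hφc : Continuous fun x => φ x - c := hφ.1.continuous.sub continuous_const
  have hφ' : Continuous fun x => fderiv ℝ φ x e :=
    (hφ.1.continuous_fderiv (by simp)).clm_apply continuous_const
  have ibp := integral_mul_fderiv_eq_neg_fderiv_mul_of_integrable (𝕜 := ℝ)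
    (μ := (volume : Measure (EuclideanSpace ℝ (Fin d))))
    (f := fun y => ρ.toFun y * ψ y) (g := fun y => φ y - c) (v := e) ?_ ?_ ?_ ?_ ?_
  · have l : ∫ x, ψ x * q.2 x i ∂ρ.measure
        = ∫ x, ρ.toFun x * ψ x * fderiv ℝ (fun y => φ y - c) x e := by
      rw [integral_congr_ae (g := fun x => ψ x * fderiv ℝ φ x e), ρ.integral_eq]
      · simp only [hd, mul_assoc]
      · filter_upwards [h2] with x hx
        rw [hx, gradient_coord]
    have r : ∫ x, (fderiv ℝ ψ x e + ψ x * fderiv ℝ ρ.logDensity x e)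
        * (q.1 : Lp ℝ 2 ρ.measure) x ∂ρ.measure
        = ∫ x, fderiv ℝ (fun y => ρ.toFun y * ψ y) x e * (φ x - c) := by
      rw [integral_congr_ae (g := fun x => (fderiv ℝ ψ x e + ψ x * fderiv ℝ ρ.logDensity x e)
        * (φ x - c)), ρ.integral_eq]
      · simp only [hg, mul_assoc]
      · filter_upwards [h1] with x hx
        rw [hx]
    rw [l, r, ibp]
  · simp only [hg]
    exact ((ρ.smooth.continuous.mul (hψ'.add (hψ.1.continuous.mul hl))).mul
      hφc).integrable_of_hasCompactSupport
      (((hψ.2.fderiv_apply ℝ e).add hψ.2.mul_right).mul_left.mul_right)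
  · simp only [hd]
    exact ((ρ.smooth.continuous.mul hψ.1.continuous).mul hφ').integrable_of_hasCompactSupport
      hψ.2.mul_left.mul_right
  · exact ((ρ.smooth.continuous.mul hψ.1.continuous).mul hφc).integrable_of_hasCompactSupport
      hψ.2.mul_left.mul_right
  · exact fun x _ => (ρ.smooth.mul hψ.1).differentiable (by simp) x
  · exact fun x _ => (hφ.1.sub contDiff_const).differentiable (by simp) x

theorem gradGraph_functional (p : L20 ρ × Lp (EuclideanSpace ℝ (Fin d)) 2 ρ.measure)
    (hp : p ∈ gradGraph ρ) (h0 : p.1 = 0) : p.2 = 0 := by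
  have hz : ∀ i : Fin d, ∀ᵐ x ∂ρ.measure, p.2 x i = 0 := by
    intro i
    have hint : Integrable (fun x => p.2 x i) ρ.measure := by
      have h := ((Lp.memLp p.2).integrable (by norm_num))
      exact (EuclideanSpace.proj (𝕜 := ℝ) i).integrable_comp h
    refine ae_eq_zero_of_integral_contDiff_smul_eq_zero hint.locallyIntegrable ?_
    intro ψ h1 h2
    have h := gradGraph_weak ρ hp ⟨h1, h2⟩ i
    simp only [smul_eq_mul]
    rw [h, neg_eq_zero]
    refine integral_eq_zero_of_ae ?_
    filter_upwards [Lp.coeFn_zero ℝ 2 ρ.measure] with x hx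
    rw [h0]
    change _ * (0 : Lp ℝ 2 ρ.measure) x = _
    rw [hx, Pi.zero_apply, mul_zero]
  refine Lp.ext ?_
  filter_upwards [ae_all_iff.2 hz,
    Lp.coeFn_zero (EuclideanSpace ℝ (Fin d)) 2 ρ.measure] with x a b
  rw [b]
  ext i
  simpa using a i

/-- The closed gradient operator `∇ : ℋ¹ → L²(π; ℝ^d)`. -/
def grad : L20 ρ →ₗ.[ℝ] Lp (EuclideanSpace ℝ (Fin d)) 2 ρ.measure :=
  (gradGraph ρ).toLinearPMap

/-- The space `ℋ¹`, as a subspace of `L²₀(π)`. -/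
def H1 : Submodule ℝ (L20 ρ) := (grad ρ).domain

/-- The differential expression `∇ log π · ∇φ + Δφ`. -/
def reversibleGenerator (φ : EuclideanSpace ℝ (Fin d) → ℝ) (x : EuclideanSpace ℝ (Fin d)) : ℝ :=
  inner ℝ (gradient ρ.logDensity x) (gradient φ x) + Laplacian.laplacian φ x

theorem reversibleGenerator_memLp {φ : EuclideanSpace ℝ (Fin d) → ℝ} (hφ : IsTest φ) :
    MemLp (reversibleGenerator ρ φ) 2 ρ.measure := by
  have hlap : Laplacian.laplacian φ = fun x => ∑ i : Fin d, iteratedFDeriv ℝ 2 φ x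
      ![EuclideanSpace.basisFun (Fin d) ℝ i, EuclideanSpace.basisFun (Fin d) ℝ i] :=
    InnerProductSpace.laplacian_eq_iteratedFDeriv_orthonormalBasis φ
      (EuclideanSpace.basisFun (Fin d) ℝ)
  have hc : Continuous (Laplacian.laplacian φ) := by
    rw [hlap]
    have := hφ.1.continuous_iteratedFDeriv (m := 2) (by norm_cast)
    fun_prop
  have hcont : Continuous (reversibleGenerator ρ φ) :=
    ((continuous_gradient ρ.smooth_log).inner (continuous_gradient hφ.1)).add hc
  refine hcont.memLp_of_hasCompactSupport ?_
  refine HasCompactSupport.intro hφ.2 fun x hx => ?_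
  have h1 : fderiv ℝ φ x = 0 := by
    by_contra h
    exact hx (support_fderiv_subset ℝ h)
  have h2 : iteratedFDeriv ℝ 2 φ x = 0 := by
    by_contra h
    exact hx (support_iteratedFDeriv_subset 2 h)
  simp [reversibleGenerator, hlap, gradient, h1, h2]

theorem integrable_mul_of_memLp {u v : EuclideanSpace ℝ (Fin d) → ℝ}
    (hu : MemLp u 2 ρ.measure) (hv : MemLp v 2 ρ.measure) :
    Integrable (fun x => u x * v x) ρ.measure := hu.integrable_mul hv

/-- The graph of `𝒮`: the pairs `(u, h)` with `u ∈ ℋ¹` and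
`∇ log π · ∇u + Δu = h ∈ L²₀(π)` in the weak sense. -/
def generatorGraph : Submodule ℝ (L20 ρ × L20 ρ) where
  carrier := {p | p.1 ∈ H1 ρ ∧ ∀ φ : EuclideanSpace ℝ (Fin d) → ℝ, IsTest φ →
    ∫ x, (p.1 : Lp ℝ 2 ρ.measure) x * reversibleGenerator ρ φ x ∂ρ.measure =
      ∫ x, (p.2 : Lp ℝ 2 ρ.measure) x * φ x ∂ρ.measure}
  zero_mem' := by
    refine ⟨(H1 ρ).zero_mem, fun φ _ => ?_⟩
    have h := Lp.coeFn_zero ℝ 2 ρ.measure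
    have key : ∀ v : EuclideanSpace ℝ (Fin d) → ℝ,
        ∫ x, ((0 : L20 ρ) : Lp ℝ 2 ρ.measure) x * v x ∂ρ.measure = 0 := by
      intro v
      refine integral_eq_zero_of_ae ?_
      filter_upwards [h] with x hx
      change (0 : Lp ℝ 2 ρ.measure) x * _ = _
      rw [hx, Pi.zero_apply, zero_mul]
    rw [Prod.fst_zero, Prod.snd_zero, key, key]
  add_mem' := by
    rintro p q ⟨hp, hp'⟩ ⟨hq, hq'⟩
    refine ⟨(H1 ρ).add_mem hp hq, fun φ hφ => ?_⟩
    have key : ∀ (a b : L20 ρ) (v : EuclideanSpace ℝ (Fin d) → ℝ), MemLp v 2 ρ.measure →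
        ∫ x, ((a + b : L20 ρ) : Lp ℝ 2 ρ.measure) x * v x ∂ρ.measure =
        ∫ x, (a : Lp ℝ 2 ρ.measure) x * v x ∂ρ.measure
          + ∫ x, (b : Lp ℝ 2 ρ.measure) x * v x ∂ρ.measure := by
      intro a b v hv
      rw [← integral_add (integrable_mul_of_memLp ρ (Lp.memLp _) hv)
        (integrable_mul_of_memLp ρ (Lp.memLp _) hv)]
      refine integral_congr_ae ?_
      filter_upwards [Lp.coeFn_add (a : Lp ℝ 2 ρ.measure) (b : Lp ℝ 2 ρ.measure)] with x hx
      change ((a : Lp ℝ 2 ρ.measure) + (b : Lp ℝ 2 ρ.measure) : Lp ℝ 2 ρ.measure) x * _ = _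
      rw [hx, Pi.add_apply, add_mul]
    rw [Prod.fst_add, Prod.snd_add, key _ _ _ (reversibleGenerator_memLp ρ hφ),
      key _ _ _ (hφ.1.continuous.memLp_of_hasCompactSupport hφ.2), hp' φ hφ, hq' φ hφ]
  smul_mem' := by
    rintro c p ⟨hp, hp'⟩
    refine ⟨(H1 ρ).smul_mem c hp, fun φ hφ => ?_⟩
    have key : ∀ (a : L20 ρ) (v : EuclideanSpace ℝ (Fin d) → ℝ),
        ∫ x, ((c • a : L20 ρ) : Lp ℝ 2 ρ.measure) x * v x ∂ρ.measure =
        c * ∫ x, (a : Lp ℝ 2 ρ.measure) x * v x ∂ρ.measure := by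
      intro a v
      rw [← integral_const_mul]
      refine integral_congr_ae ?_
      filter_upwards [Lp.coeFn_smul c (a : Lp ℝ 2 ρ.measure)] with x hx
      change (c • (a : Lp ℝ 2 ρ.measure) : Lp ℝ 2 ρ.measure) x * _ = _
      rw [hx, Pi.smul_apply, smul_eq_mul, mul_assoc]
    rw [Prod.smul_fst, Prod.smul_snd, key, key, hp' φ hφ]

theorem generatorGraph_functional (p : L20 ρ × L20 ρ)
    (hp : p ∈ generatorGraph ρ) (h0 : p.1 = 0) : p.2 = 0 := by
  have hint : Integrable (fun x => (p.2 : Lp ℝ 2 ρ.measure) x) ρ.measure :=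
    (Lp.memLp (p.2 : Lp ℝ 2 ρ.measure)).integrable (by norm_num)
  refine Subtype.ext (Lp.ext ?_)
  have hz := ae_eq_zero_of_integral_contDiff_smul_eq_zero hint.locallyIntegrable (by
    intro ψ h1 h2
    have h := hp.2 ψ ⟨h1, h2⟩
    simp only [smul_eq_mul, mul_comm (ψ _)]
    rw [← h]
    refine integral_eq_zero_of_ae ?_
    filter_upwards [Lp.coeFn_zero ℝ 2 ρ.measure] with x hx
    rw [h0]
    change (0 : Lp ℝ 2 ρ.measure) x * _ = _
    rw [hx, Pi.zero_apply, zero_mul])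
  filter_upwards [hz, Lp.coeFn_zero ℝ 2 ρ.measure] with x a b
  exact a.trans b.symm

/-- The self-adjoint generator `𝒮 = ∇ log π · ∇ + Δ` of the reversible dynamics on `L²₀(π)`. -/
def symmetricGenerator : L20 ρ →ₗ.[ℝ] L20 ρ := (generatorGraph ρ).toLinearPMap

theorem symmetricGenerator_domain_le : (symmetricGenerator ρ).domain ≤ H1 ρ := by
  rintro u ⟨p, hp, rfl⟩
  exact hp.1

/-- The graph of `𝒜 = γ · ∇ : ℋ¹ → L²₀(π)`. -/
def advectionGraph (γ : EuclideanSpace ℝ (Fin d) → EuclideanSpace ℝ (Fin d)) :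
    Submodule ℝ (L20 ρ × L20 ρ) where
  carrier := {p | ∃ hu : p.1 ∈ H1 ρ,
    (p.2 : Lp ℝ 2 ρ.measure) =ᵐ[ρ.measure] fun x => inner ℝ (γ x) (grad ρ ⟨p.1, hu⟩ x)}
  zero_mem' := by
    refine ⟨(H1 ρ).zero_mem, ?_⟩
    have e : grad ρ ⟨(0 : L20 ρ × L20 ρ).1, (H1 ρ).zero_mem⟩ = 0 := (grad ρ).map_zero
    rw [e]
    filter_upwards [Lp.coeFn_zero ℝ 2 ρ.measure,
      Lp.coeFn_zero (EuclideanSpace ℝ (Fin d)) 2 ρ.measure] with x hx hx'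
    change (0 : Lp ℝ 2 ρ.measure) x = _
    rw [hx, hx']
    simp
  add_mem' := by
    rintro p q ⟨hp, hp'⟩ ⟨hq, hq'⟩
    refine ⟨(H1 ρ).add_mem hp hq, ?_⟩
    have e : grad ρ ⟨(p + q).1, (H1 ρ).add_mem hp hq⟩ = grad ρ ⟨p.1, hp⟩ + grad ρ ⟨q.1, hq⟩ :=
      (grad ρ).map_add ⟨p.1, hp⟩ ⟨q.1, hq⟩
    rw [e]
    filter_upwards [hp', hq', Lp.coeFn_add (p.2 : Lp ℝ 2 ρ.measure) (q.2 : Lp ℝ 2 ρ.measure),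
      Lp.coeFn_add (grad ρ ⟨p.1, hp⟩) (grad ρ ⟨q.1, hq⟩)] with x a b c c'
    change ((p.2 : Lp ℝ 2 ρ.measure) + (q.2 : Lp ℝ 2 ρ.measure) : Lp ℝ 2 ρ.measure) x = _
    rw [c, c', Pi.add_apply, Pi.add_apply, a, b, inner_add_right]
  smul_mem' := by
    rintro c p ⟨hp, hp'⟩
    refine ⟨(H1 ρ).smul_mem c hp, ?_⟩
    have e : grad ρ ⟨(c • p).1, (H1 ρ).smul_mem c hp⟩ = c • grad ρ ⟨p.1, hp⟩ :=
      (grad ρ).map_smul c ⟨p.1, hp⟩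
    rw [e]
    filter_upwards [hp', Lp.coeFn_smul c (p.2 : Lp ℝ 2 ρ.measure),
      Lp.coeFn_smul c (grad ρ ⟨p.1, hp⟩)] with x a b b'
    change (c • (p.2 : Lp ℝ 2 ρ.measure) : Lp ℝ 2 ρ.measure) x = _
    rw [b, b', Pi.smul_apply, Pi.smul_apply, a, inner_smul_right, smul_eq_mul]

theorem advectionGraph_functional (γ : EuclideanSpace ℝ (Fin d) → EuclideanSpace ℝ (Fin d))
    (p : L20 ρ × L20 ρ) (hp : p ∈ advectionGraph ρ γ) (h0 : p.1 = 0) : p.2 = 0 := by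
  obtain ⟨u, h⟩ := p
  obtain ⟨hu, hh⟩ := hp
  change u = 0 at h0
  subst h0
  have e : grad ρ ⟨0, hu⟩ = 0 := (grad ρ).map_zero
  rw [e] at hh
  refine Subtype.ext (Lp.ext ?_)
  filter_upwards [hh, Lp.coeFn_zero ℝ 2 ρ.measure,
    Lp.coeFn_zero (EuclideanSpace ℝ (Fin d)) 2 ρ.measure] with x a b c
  change (h : Lp ℝ 2 ρ.measure) x = (0 : Lp ℝ 2 ρ.measure) x
  rw [b]
  refine a.trans ?_
  change inner ℝ (γ x) ((0 : Lp (EuclideanSpace ℝ (Fin d)) 2 ρ.measure) x) = _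
  rw [c]
  simp

/-- The operator `𝒜 = γ · ∇` in `L²₀(π)`, on the `u ∈ ℋ¹` with `γ · ∇u ∈ L²₀(π)`. -/
def advection (γ : EuclideanSpace ℝ (Fin d) → EuclideanSpace ℝ (Fin d)) :
    L20 ρ →ₗ.[ℝ] L20 ρ := (advectionGraph ρ γ).toLinearPMap

/-- `ℒ = 𝒮 + α 𝒜`, with domain the intersection of the two domains. -/
def generator (γ : EuclideanSpace ℝ (Fin d) → EuclideanSpace ℝ (Fin d)) (α : ℝ) :
    L20 ρ →ₗ.[ℝ] L20 ρ := symmetricGenerator ρ + α • advection ρ γ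

/-- The asymptotic variance `σ_f²(α) = 2 ∫ |∇φ|² dπ`, where `φ ∈ ℋ¹` is the solution of
the Poisson equation `-ℒφ = f` (and `0` if there is no solution). -/
def asymptoticVariance (γ : EuclideanSpace ℝ (Fin d) → EuclideanSpace ℝ (Fin d)) (α : ℝ)
    (f : L20 ρ) : ℝ :=
  open Classical in
  if h : ∃ φ : H1 ρ, ∃ hφ : (φ : L20 ρ) ∈ (generator ρ γ α).domain,
      -(generator ρ γ α ⟨φ, hφ⟩) = f then
    2 * ∫ x, ‖grad ρ h.choose x‖ ^ 2 ∂ρ.measure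
  else 0

end Target

/-- The composition `T U` on its natural domain `{u ∈ D(U) | U u ∈ D(T)}`. -/
def compPartial {E F G : Type*} [AddCommGroup E] [Module ℝ E] [AddCommGroup F] [Module ℝ F]
    [AddCommGroup G] [Module ℝ G] (T : F →ₗ.[ℝ] G) (U : E →ₗ.[ℝ] F) : E →ₗ.[ℝ] G :=
  T.comp (U.domRestrict ((T.domain.comap U.toFun).map U.domain.subtype)) (by
    rintro ⟨x, hx⟩
    obtain ⟨⟨y, hy, rfl⟩, hx2⟩ := hx
    exact hy)

/-- The bounded, everywhere defined operator `R` is the inverse `T⁻¹` of the unbounded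
operator `T`. -/
def IsBoundedInverse {H : Type*} [NormedAddCommGroup H] [InnerProductSpace ℝ H]
    (T : H →ₗ.[ℝ] H) (R : H →L[ℝ] H) : Prop :=
  (∀ u : T.domain, R (T u) = u) ∧ ∀ f : H, ∃ h : R f ∈ T.domain, T ⟨R f, h⟩ = f

/-- The symmetric part `[R]^S = (R + R*) / 2` of a bounded operator. -/
def symmetricPart {H : Type*} [NormedAddCommGroup H] [InnerProductSpace ℝ H] [CompleteSpace H]
    (R : H →L[ℝ] H) : H →L[ℝ] H :=
  (1 / 2 : ℝ) • (R + ContinuousLinearMap.adjoint R)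

end NonreversibleLangevin

end

open NonreversibleLangevin

/-!
With `l = log π`, `H = L²₀(π)` and `W ⊆ L²(π; ℝ^d)` the range of the closed gradient, everything
follows from two facts.

*Poincaré inequality.* For a test function `h`, the weighted divergence of `h² ∇l` integrates to
zero, and completing the square gives `∫ β ((1 - β) |∇l|² + Δl) h² dπ ≤ ∫ |∇h|² dπ`
(`integral_lyapunovWeight_mul_sq_le`). By the drift condition the weight is bounded below by some
`θ > 0` outside a ball. On the ball, `π` is comparable with Lebesgue measure, and the Poincaré
inequality there follows by integrating the gradient along segments
(`exists_setIntegral_sq_sub_le`). Applied to `φ - m`, cut off at infinity, these give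
`exists_integral_sq_sub_le`, hence `‖u‖ ≤ c ‖∇u‖` on `ℋ¹`. So `W` is closed, and the gradient has
a bounded inverse `J : W → H`.

*Skew factorisation.* `-𝒮 = ∇* ∇` has the inverse `J J*`. Since `∇ · (γ π) = 0`, the operator
`𝒜 = K J⁻¹` is antisymmetric on `ℋ¹`, where `K : W → H` is multiplication by `γ`; thus `N = J* K` is
a bounded skew operator on `W`. Then `P = (1 - α N)⁻¹` exists by Lax–Milgram, and
`(-ℒ)⁻¹ = J P J*`. The symmetric part of `P` is `(1 - α² N²)⁻¹`, and `J (1 - α² N²)⁻¹ J*` inverts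
`-𝒮 + α² 𝒜* (-𝒮)⁻¹ 𝒜`. Finally `⟨f, J P J* f⟩ = ‖P J* f‖² ≤ ‖J* f‖² = ⟨f, J J* f⟩`, and `P J* f`
is the gradient of the solution of the Poisson equation
(`exists_inverses_of_factorisation`).
-/

noncomputable section

namespace NonreversibleLangevin

/-! ### Graphs of partially defined operators -/

section Graph

variable {E F G : Type*} [AddCommGroup E] [Module ℝ E] [AddCommGroup F] [Module ℝ F]
  [AddCommGroup G] [Module ℝ G]

theorem mem_graph_iff_exists {T : E →ₗ.[ℝ] F} {u : E} {f : F} :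
    (u, f) ∈ T.graph ↔ ∃ h : u ∈ T.domain, T ⟨u, h⟩ = f := by
  rw [LinearPMap.mem_graph_iff]
  constructor
  · rintro ⟨⟨y, hy⟩, rfl, h⟩
    exact ⟨hy, h⟩
  · rintro ⟨h, e⟩
    exact ⟨⟨u, h⟩, rfl, e⟩

theorem mem_graph_add {T U : E →ₗ.[ℝ] F} {u : E} {f : F} :
    (u, f) ∈ (T + U).graph ↔ ∃ a b, (u, a) ∈ T.graph ∧ (u, b) ∈ U.graph ∧ a + b = f := by
  simp only [mem_graph_iff_exists]
  constructor
  · rintro ⟨⟨h1, h2⟩, rfl⟩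
    exact ⟨_, _, ⟨h1, rfl⟩, ⟨h2, rfl⟩, rfl⟩
  · rintro ⟨_, _, ⟨h1, rfl⟩, ⟨h2, rfl⟩, rfl⟩
    exact ⟨⟨h1, h2⟩, rfl⟩

theorem mem_graph_neg {T : E →ₗ.[ℝ] F} {u : E} {f : F} :
    (u, f) ∈ (-T).graph ↔ (u, -f) ∈ T.graph := by
  simp only [mem_graph_iff_exists]
  constructor
  · rintro ⟨h, rfl⟩
    exact ⟨h, (neg_neg _).symm⟩
  · rintro ⟨h, e⟩
    exact ⟨h, by rw [LinearPMap.neg_apply, ← neg_neg f, ← e]⟩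

theorem mem_graph_smul {T : E →ₗ.[ℝ] F} {c : ℝ} {u : E} {f : F} :
    (u, f) ∈ (c • T).graph ↔ ∃ a, (u, a) ∈ T.graph ∧ c • a = f := by
  simp only [mem_graph_iff_exists]
  constructor
  · rintro ⟨h, rfl⟩
    exact ⟨_, ⟨h, rfl⟩, rfl⟩
  · rintro ⟨_, ⟨h, rfl⟩, rfl⟩
    exact ⟨h, rfl⟩

theorem mem_graph_compPartial {T : F →ₗ.[ℝ] G} {U : E →ₗ.[ℝ] F} {u : E} {g : G} :
    (u, g) ∈ (compPartial T U).graph ↔ ∃ f, (u, f) ∈ U.graph ∧ (f, g) ∈ T.graph := by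
  simp only [mem_graph_iff_exists]
  constructor
  · rintro ⟨h, rfl⟩
    obtain ⟨⟨⟨y, hy⟩, hy', rfl⟩, _⟩ := id h
    exact ⟨_, ⟨hy, rfl⟩, hy', rfl⟩
  · rintro ⟨_, ⟨h, rfl⟩, ⟨h', rfl⟩⟩
    exact ⟨⟨⟨⟨u, h⟩, h', rfl⟩, h⟩, rfl⟩

theorem mem_graph_inverse {T : E →ₗ.[ℝ] F} (hT : LinearMap.ker T.toFun = ⊥) {f : F} {u : E} :
    (f, u) ∈ T.inverse.graph ↔ (u, f) ∈ T.graph := by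
  rw [LinearPMap.inverse_graph hT]
  simp

end Graph

section Hilbert

variable {H : Type*} [NormedAddCommGroup H] [InnerProductSpace ℝ H]

theorem isBoundedInverse_iff_mem_graph {T : H →ₗ.[ℝ] H} {R : H →L[ℝ] H} :
    IsBoundedInverse T R ↔ ∀ u f, (u, f) ∈ T.graph ↔ R f = u := by
  simp only [mem_graph_iff_exists]
  constructor
  · rintro ⟨h1, h2⟩ u f
    constructor
    · rintro ⟨h, rfl⟩
      exact h1 ⟨u, h⟩
    · rintro rfl
      exact h2 f
  · intro h
    exact ⟨fun u => (h _ _).1 ⟨u.2, rfl⟩, fun f => (h _ _).2 rfl⟩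

theorem IsBoundedInverse.ker_eq_bot {T : H →ₗ.[ℝ] H} {R : H →L[ℝ] H}
    (h : IsBoundedInverse T R) : LinearMap.ker T.toFun = ⊥ := by
  rw [LinearMap.ker_eq_bot']
  intro u hu
  have := h.1 u
  change T u = 0 at hu
  rw [hu, map_zero] at this
  exact Subtype.ext this.symm

/-! ### Skew perturbations of a symmetric operator in factorised form -/

variable {W : Type*} [NormedAddCommGroup W] [InnerProductSpace ℝ W]

theorem inner_self_eq_zero_of_skew {N : W →L[ℝ] W}
    (hN : ∀ v w, inner ℝ (N v) w = -inner ℝ v (N w)) (w : W) : inner ℝ (N w) w = 0 := by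
  have h1 := hN w w
  have h2 := real_inner_comm w (N w)
  linarith

theorem inner_inverse_one_sub_smul_of_skew {N P : W →L[ℝ] W}
    (hN : ∀ v w, inner ℝ (N v) w = -inner ℝ v (N w)) {a : ℝ}
    (hP : ∀ w, P w - a • N (P w) = w) (w : W) : inner ℝ w (P w) = ‖P w‖ ^ 2 := by
  have h0 : inner ℝ (N (P w)) (P w) = 0 := inner_self_eq_zero_of_skew hN _
  conv_lhs => rw [← hP w]
  rw [(by rw [hP] : P (P w - a • N (P w)) = P w), inner_sub_left, inner_smul_left, h0,
    real_inner_self_eq_norm_sq]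
  simp

theorem norm_inverse_one_sub_smul_le_of_skew {N P : W →L[ℝ] W}
    (hN : ∀ v w, inner ℝ (N v) w = -inner ℝ v (N w)) {a : ℝ}
    (hP : ∀ w, P w - a • N (P w) = w) (w : W) : ‖P w‖ ≤ ‖w‖ := by
  have h1 := inner_inverse_one_sub_smul_of_skew hN hP w
  have h2 := real_inner_le_norm w (P w)
  by_contra! h
  nlinarith [norm_nonneg w, norm_nonneg (P w)]

variable [CompleteSpace W]

/-- For a bounded skew operator `N` the operator `1 - a N` is coercive, hence invertible. -/
theorem exists_inverse_one_sub_smul_of_skew (N : W →L[ℝ] W)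
    (hN : ∀ v w, inner ℝ (N v) w = -inner ℝ v (N w)) (a : ℝ) :
    ∃ P : W →L[ℝ] W, (∀ w, P w - a • N (P w) = w) ∧ ∀ w, P (w - a • N w) = w := by
  have h0 : ∀ w, inner ℝ (N w) w = 0 := inner_self_eq_zero_of_skew hN
  let B : W →L[ℝ] W →L[ℝ] ℝ := (innerSL ℝ).comp (ContinuousLinearMap.id ℝ W - a • N)
  have hBv : ∀ v w, B v w = inner ℝ (v - a • N v) w := fun v w => rfl
  have hB : IsCoercive B := ⟨1, one_pos, fun w => by
    rw [hBv, inner_sub_left, inner_smul_left, h0, real_inner_self_eq_norm_mul_norm]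
    simp⟩
  have he : ∀ w, hB.continuousLinearEquivOfBilin w = w - a • N w := fun w =>
    (hB.unique_continuousLinearEquivOfBilin fun v => (hBv w v).symm).symm
  refine ⟨hB.continuousLinearEquivOfBilin.symm.toContinuousLinearMap, fun w => ?_, fun w => ?_⟩
  · rw [← he]
    exact hB.continuousLinearEquivOfBilin.apply_symm_apply w
  · rw [← he]
    exact hB.continuousLinearEquivOfBilin.symm_apply_apply w

/-- The symmetric part of `(1 - a N)⁻¹` for skew `N` is `(1 - a² N²)⁻¹`. -/
theorem symmetricPart_inverse_one_sub_smul_iff {N P : W →L[ℝ] W}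
    (hN : ∀ v w, inner ℝ (N v) w = -inner ℝ v (N w)) {a : ℝ}
    (hP : ∀ w, P w - a • N (P w) = w) (hP' : ∀ w, P (w - a • N w) = w) (v w : W) :
    symmetricPart P v = w ↔ w - a ^ 2 • N (N w) = v := by
  obtain ⟨Q, hQ, hQ'⟩ := exists_inverse_one_sub_smul_of_skew N hN (-a)
  -- `P = (1 - a N)⁻¹` has the adjoint `Q = (1 + a N)⁻¹`, as `N* = -N`
  have hadj : ContinuousLinearMap.adjoint P = Q := by
    refine (ContinuousLinearMap.eq_adjoint_iff _ _ |>.2 fun x y => ?_).symm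
    conv_lhs => rw [← hP y]
    conv_rhs => rw [← hQ x]
    simp only [inner_sub_left, inner_sub_right, inner_smul_left, inner_smul_right, hN (Q x)]
    simp
  have hZ : symmetricPart P = (1 / 2 : ℝ) • (P + Q) := by rw [symmetricPart, hadj]
  -- `1 - a² N² = (1 + a N) (1 - a N)`, in both orders
  have hf : ∀ w, w - a ^ 2 • N (N w)
      = (w - a • N w) - (-a) • N (w - a • N w) := fun w => by
    simp only [map_sub, map_smul]; module
  have hf' : ∀ w, w - a ^ 2 • N (N w)
      = (w - (-a) • N w) - a • N (w - (-a) • N w) := fun w => by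
    simp only [map_sub, map_smul]; module
  have hl : ∀ w, symmetricPart P (w - a ^ 2 • N (N w)) = w := fun w => by
    have h1 : P (w - a ^ 2 • N (N w)) = w - (-a) • N w := by rw [hf', hP']
    have h2 : Q (w - a ^ 2 • N (N w)) = w - a • N w := by rw [hf, hQ']
    rw [hZ, smul_apply, add_apply, h1, h2]
    module
  have hr : ∀ v, symmetricPart P v - a ^ 2 • N (N (symmetricPart P v)) = v := fun v => by
    have h1 : P v - a ^ 2 • N (N (P v)) = v - (-a) • N v := by rw [hf, hP]
    have h2 : Q v - a ^ 2 • N (N (Q v)) = v - a • N v := by rw [hf', hQ]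
    have h3 : symmetricPart P v - a ^ 2 • N (N (symmetricPart P v))
        = (1 / 2 : ℝ) • ((P v - a ^ 2 • N (N (P v))) + (Q v - a ^ 2 • N (N (Q v)))) := by
      rw [hZ]
      simp only [smul_apply, add_apply, map_smul, map_add]
      module
    rw [h3, h1, h2]
    module
  constructor
  · rintro rfl
    exact hr v
  · rintro rfl
    exact hl w

variable [CompleteSpace H]

theorem inner_adjoint_comp_skew {J K : W →L[ℝ] H}
    (hskew : ∀ v w, inner ℝ (K v) (J w) = -inner ℝ (J v) (K w)) (v w : W) :
    inner ℝ ((ContinuousLinearMap.adjoint J ∘L K) v) w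
      = -inner ℝ v ((ContinuousLinearMap.adjoint J ∘L K) w) := by
  simp only [ContinuousLinearMap.comp_apply]
  rw [ContinuousLinearMap.adjoint_inner_left, ContinuousLinearMap.adjoint_inner_right, hskew]

/-- If `-S = (J J*)⁻¹` and `A = K J⁻¹`, then `-(S + a A) = (J P J*)⁻¹` with
`P = (1 - a J* K)⁻¹`. -/
theorem isBoundedInverse_neg_add_smul {J K : W →L[ℝ] H} (hJ : Function.Injective J)
    {A S : H →ₗ.[ℝ] H} (hA : ∀ u f, (u, f) ∈ A.graph ↔ ∃ w, J w = u ∧ K w = f)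
    (hS : IsBoundedInverse (-S) (J ∘L ContinuousLinearMap.adjoint J)) {a : ℝ} {P : W →L[ℝ] W}
    (hP : ∀ w, P w - a • (ContinuousLinearMap.adjoint J ∘L K) (P w) = w)
    (hP' : ∀ w, P (w - a • (ContinuousLinearMap.adjoint J ∘L K) w) = w) :
    IsBoundedInverse (-(S + a • A)) (J ∘L P ∘L ContinuousLinearMap.adjoint J) := by
  rw [isBoundedInverse_iff_mem_graph] at hS ⊢
  replace hS : ∀ u f, (u, f) ∈ S.graph ↔ J (ContinuousLinearMap.adjoint J (-f)) = u :=
    fun u f => by rw [← ContinuousLinearMap.comp_apply, ← hS, mem_graph_neg, neg_neg]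
  intro u f
  rw [mem_graph_neg, mem_graph_add]
  simp only [mem_graph_smul, hS, hA]
  simp only [ContinuousLinearMap.comp_apply] at hP hP' ⊢
  constructor
  · rintro ⟨h, _, hh, ⟨_, ⟨w, rfl, rfl⟩, rfl⟩, e⟩
    have e' : f = -h - a • K w := by rw [← neg_eq_iff_eq_neg.2 e]; module
    rw [e', map_sub, map_smul, hJ hh, hP']
  · rintro rfl
    set w := P (ContinuousLinearMap.adjoint J f) with hw
    refine ⟨-f - a • K w, _, ?_, ⟨_, ⟨w, rfl, rfl⟩, rfl⟩, by module⟩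
    have := hP (ContinuousLinearMap.adjoint J f)
    rw [← hw] at this
    rw [neg_sub, sub_neg_eq_add, map_add, map_smul, ← this]
    congr 1
    module

/-- If `-S = (J J*)⁻¹`, `A = K J⁻¹` is antisymmetric and `P = (1 - a J* K)⁻¹`, then the operator
`-S + a² A* (-S)⁻¹ A` is `(J (1 - a² (J* K)²)⁻¹ J*)⁻¹`, and this inverse is the symmetric part
of `J P J*`. -/
theorem isBoundedInverse_symmetricPart {J K : W →L[ℝ] H} (hJ : Function.Injective J)
    (hskew : ∀ v w, inner ℝ (K v) (J w) = -inner ℝ (J v) (K w))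
    {A S : H →ₗ.[ℝ] H} (hA : ∀ u f, (u, f) ∈ A.graph ↔ ∃ w, J w = u ∧ K w = f)
    (hA' : -A ≤ A.adjoint)
    (hS : IsBoundedInverse (-S) (J ∘L ContinuousLinearMap.adjoint J)) {a : ℝ} {P : W →L[ℝ] W}
    (hP : ∀ w, P w - a • (ContinuousLinearMap.adjoint J ∘L K) (P w) = w)
    (hP' : ∀ w, P (w - a • (ContinuousLinearMap.adjoint J ∘L K) w) = w) :
    IsBoundedInverse (-S + a ^ 2 • compPartial A.adjoint (compPartial (-S).inverse A))
      (symmetricPart (J ∘L P ∘L ContinuousLinearMap.adjoint J)) := by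
  have hsym : ∀ f, symmetricPart (J ∘L P ∘L ContinuousLinearMap.adjoint J) f
      = J (symmetricPart P (ContinuousLinearMap.adjoint J f)) := fun f => by
    simp only [symmetricPart, ContinuousLinearMap.adjoint_comp,
      ContinuousLinearMap.adjoint_adjoint, smul_apply, add_apply,
      ContinuousLinearMap.comp_apply, map_smul, map_add]
  have hker := hS.ker_eq_bot
  have hZ := symmetricPart_inverse_one_sub_smul_iff (inner_adjoint_comp_skew hskew) hP hP'
  rw [isBoundedInverse_iff_mem_graph] at hS ⊢
  have hadj : ∀ w g, (J w, g) ∈ A.adjoint.graph ↔ g = -K w := fun w g => by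
    have h : (J w, -K w) ∈ A.adjoint.graph :=
      LinearPMap.le_graph_of_le hA' (by rw [mem_graph_neg, neg_neg, hA]; exact ⟨w, rfl, rfl⟩)
    exact ⟨fun hg => LinearPMap.mem_graph_snd_inj _ hg h rfl, fun hg => hg ▸ h⟩
  intro u f
  rw [mem_graph_add]
  simp only [mem_graph_smul, mem_graph_compPartial, mem_graph_inverse hker, hS, hA, hsym]
  simp only [ContinuousLinearMap.comp_apply] at hZ ⊢
  constructor
  · rintro ⟨h, _, hh, ⟨g, ⟨_, ⟨_, ⟨w, rfl, rfl⟩, rfl⟩, hg⟩, rfl⟩, rfl⟩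
    rw [hadj] at hg
    subst hg
    congr 1
    rw [hZ, map_add, map_smul, map_neg, hJ hh]
    module
  · rintro rfl
    obtain ⟨w, hw⟩ : ∃ w, w = symmetricPart P (ContinuousLinearMap.adjoint J f) := ⟨_, rfl⟩
    have h := (hZ _ _).1 hw.symm
    rw [← hw]
    refine ⟨f + a ^ 2 • K (ContinuousLinearMap.adjoint J (K w)), _, ?_,
      ⟨-K (ContinuousLinearMap.adjoint J (K w)), ⟨_, ⟨_, ⟨w, rfl, rfl⟩, rfl⟩, ?_⟩, rfl⟩,
      by module⟩
    · rw [map_add, map_smul, ← h]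
      congr 1
      module
    · rw [hadj]

/-- A closed operator bounded below has closed range `W`, and its inverse is a bounded operator
`J : W → H`. -/
theorem exists_bounded_inverse_on_range {E : Type*} [NormedAddCommGroup E]
    [InnerProductSpace ℝ E] [CompleteSpace E] (D : H →ₗ.[ℝ] E)
    (hD : IsClosed (D.graph : Set (H × E)))
    {c : ℝ} (hc : ∀ u : D.domain, ‖(u : H)‖ ≤ c * ‖D u‖) :
    ∃ (W : Submodule ℝ E) (J : W →L[ℝ] H), IsClosed (W : Set E) ∧ Function.Injective J ∧
      ∀ (u : H) (w : E), (u, w) ∈ D.graph ↔ ∃ h : w ∈ W, J ⟨w, h⟩ = u := by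
  have hker : LinearMap.ker D.toFun = ⊥ := by
    rw [LinearMap.ker_eq_bot']
    intro u hu
    have := hc u
    change D u = 0 at hu
    rw [hu, norm_zero, mul_zero, norm_le_zero_iff] at this
    exact Subtype.ext this
  have hg : ∀ u w, (u, w) ∈ D.graph → ‖u‖ ≤ c * ‖w‖ := fun u w h => by
    obtain ⟨hu, rfl⟩ := mem_graph_iff_exists.1 h
    exact hc ⟨u, hu⟩
  have hJ : ∀ w : D.inverse.domain, ‖D.inverse w‖ ≤ c * ‖(w : E)‖ := fun w =>
    hg _ _ ((mem_graph_inverse hker).1 (LinearPMap.mem_graph _ w))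
  refine ⟨D.inverse.domain, LinearMap.mkContinuous D.inverse.toFun c hJ, ?_, ?_, ?_⟩
  · refine isClosed_of_closure_subset fun w hw => ?_
    obtain ⟨x, hx, hxw⟩ := mem_closure_iff_seq_limit.1 hw
    have hx' : ∀ n, (D.inverse ⟨x n, hx n⟩, x n) ∈ D.graph := fun n =>
      (mem_graph_inverse hker).1 (LinearPMap.mem_graph _ ⟨x n, hx n⟩)
    have hcau : CauchySeq fun n => D.inverse ⟨x n, hx n⟩ := by
      have hb : ∀ m n, dist (D.inverse ⟨x m, hx m⟩) (D.inverse ⟨x n, hx n⟩)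
          ≤ |c| * dist (x m) (x n) := fun m n => by
        rw [dist_eq_norm, dist_eq_norm]
        refine (hg _ _ (D.graph.sub_mem (hx' m) (hx' n))).trans ?_
        exact mul_le_mul_of_nonneg_right (le_abs_self c) (norm_nonneg _)
      have hxc := hxw.cauchySeq
      rw [Metric.cauchySeq_iff] at hxc ⊢
      intro ε hε
      obtain ⟨N, hN⟩ := hxc (ε / (|c| + 1)) (by positivity)
      refine ⟨N, fun m hm n hn => (hb m n).trans_lt ?_⟩
      have h1 := hN m hm n hn
      rw [lt_div_iff₀ (by positivity)] at h1
      nlinarith [dist_nonneg (x := x m) (y := x n)]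
    obtain ⟨u, hu⟩ := cauchySeq_tendsto_of_complete hcau
    have hm : (u, w) ∈ D.graph :=
      hD.mem_of_tendsto (hu.prodMk_nhds hxw) (Filter.Eventually.of_forall hx')
    exact LinearPMap.mem_domain_of_mem_graph ((mem_graph_inverse hker).2 hm)
  · rw [injective_iff_map_eq_zero]
    intro w hw
    have h := (mem_graph_inverse hker).1 (LinearPMap.mem_graph _ w)
    change D.inverse w = 0 at hw
    rw [hw] at h
    exact Subtype.ext (LinearPMap.graph_fst_eq_zero_snd _ h rfl)
  · intro u w
    rw [← mem_graph_inverse hker, mem_graph_iff_exists]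
    rfl

/-- If `-S = D* D` for an operator `D` with graph `Γ`, and `J` inverts `D` on its range `W`, then
`(-S)⁻¹ = J J*`. -/
theorem isBoundedInverse_neg_of_variational {E : Type*} [NormedAddCommGroup E]
    [InnerProductSpace ℝ E] {Γ : Submodule ℝ (H × E)} {W : Submodule ℝ E} [CompleteSpace W]
    {J : W →L[ℝ] H} (hJ : ∀ u w, (u, w) ∈ Γ ↔ ∃ h : w ∈ W, J ⟨w, h⟩ = u) {S : H →ₗ.[ℝ] H}
    (hS : ∀ u h, (u, h) ∈ S.graph ↔
      ∃ w, (u, w) ∈ Γ ∧ ∀ q ∈ Γ, -inner ℝ w q.2 = inner ℝ h q.1) :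
    IsBoundedInverse (-S) (J ∘L ContinuousLinearMap.adjoint J) := by
  rw [isBoundedInverse_iff_mem_graph]
  intro u f
  rw [mem_graph_neg, hS, ContinuousLinearMap.comp_apply]
  constructor
  · rintro ⟨w, hw, h⟩
    obtain ⟨hw, rfl⟩ := (hJ u w).1 hw
    congr 1
    refine ext_inner_right ℝ fun v => ?_
    have h1 := h _ ((hJ (J v) v).2 ⟨v.2, rfl⟩)
    rw [inner_neg_left, neg_inj] at h1
    rw [ContinuousLinearMap.adjoint_inner_left]
    exact h1.symm
  · rintro rfl
    refine ⟨_, (hJ _ _).2 ⟨(ContinuousLinearMap.adjoint J f).2, rfl⟩, fun q hq => ?_⟩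
    obtain ⟨hq2, hq1⟩ := (hJ q.1 q.2).1 hq
    rw [← hq1, inner_neg_left, ← ContinuousLinearMap.adjoint_inner_left, Submodule.coe_inner]

/-- The resolvent identity and the comparison of the quadratic forms, for `-S = (J J*)⁻¹` and
antisymmetric `A = K J⁻¹`. -/
theorem exists_inverses_of_factorisation {J K : W →L[ℝ] H} (hJ : Function.Injective J)
    (hskew : ∀ v w, inner ℝ (K v) (J w) = -inner ℝ (J v) (K w))
    {A S : H →ₗ.[ℝ] H} (hA : ∀ u f, (u, f) ∈ A.graph ↔ ∃ w, J w = u ∧ K w = f)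
    (hA' : -A ≤ A.adjoint)
    (hS : IsBoundedInverse (-S) (J ∘L ContinuousLinearMap.adjoint J)) (a : ℝ) :
    ∃ R R₀ : H →L[ℝ] H, IsBoundedInverse (-(S + a • A)) R ∧
      IsBoundedInverse (-(S + (0 : ℝ) • A)) R₀ ∧ IsBoundedInverse (-S) R₀ ∧
      IsBoundedInverse (-S + a ^ 2 • compPartial A.adjoint (compPartial (-S).inverse A))
        (symmetricPart R) ∧
      ∀ f, ∃ w w₀, J w = R f ∧ J w₀ = R₀ f ∧ inner ℝ f (R f) = ‖w‖ ^ 2 ∧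
        inner ℝ f (R₀ f) = ‖w₀‖ ^ 2 ∧ ‖w‖ ≤ ‖w₀‖ := by
  have hN := inner_adjoint_comp_skew hskew
  obtain ⟨P, hP, hP'⟩ := exists_inverse_one_sub_smul_of_skew _ hN a
  refine ⟨_, _, isBoundedInverse_neg_add_smul hJ hA hS hP hP',
    isBoundedInverse_neg_add_smul hJ hA hS (P := ContinuousLinearMap.id ℝ W) (by simp) (by simp),
    hS, isBoundedInverse_symmetricPart hJ hskew hA hA' hS hP hP', fun f => ?_⟩
  refine ⟨P (ContinuousLinearMap.adjoint J f), ContinuousLinearMap.adjoint J f, rfl, rfl, ?_, ?_,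
    norm_inverse_one_sub_smul_le_of_skew hN hP _⟩
  · rw [← inner_inverse_one_sub_smul_of_skew hN hP]
    exact (ContinuousLinearMap.adjoint_inner_left J _ f).symm
  · rw [← real_inner_self_eq_norm_sq]
    exact (ContinuousLinearMap.adjoint_inner_left J _ f).symm

end Hilbert

/-! ### The Poincaré inequality on a ball -/

section LocalPoincare

open Set

variable {X : Type*} [NormedAddCommGroup X] [NormedSpace ℝ X] [FiniteDimensional ℝ X]
  [MeasurableSpace X] [BorelSpace X] (μ : Measure X) [μ.IsAddHaarMeasure]

theorem lintegral_comp_add_smul {F : X → ENNReal} (hF : Measurable F) (v : X) {t : ℝ}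
    (ht : t ≠ 0) :
    ∫⁻ y, F (v + t • y) ∂μ
      = ENNReal.ofReal |(t ^ Module.finrank ℝ X)⁻¹| * ∫⁻ y, F y ∂μ := by
  have h1 : ∫⁻ y, F (v + y) ∂(Measure.map (t • ·) μ) = ∫⁻ y, F (v + t • y) ∂μ :=
    lintegral_map (hF.comp (measurable_const_add v)) (measurable_const_smul t)
  rw [← h1, Measure.map_addHaar_smul μ ht, lintegral_smul_measure, lintegral_add_left_eq_self,
    smul_eq_mul]

theorem setLIntegral_convexCombination_le {F : X → ENNReal} (hF : Measurable F) (s : Set X)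
    {t : ℝ} (ht : 1 / 2 ≤ t) :
    ∫⁻ x in s, ∫⁻ y in s, F ((1 - t) • x + t • y) ∂μ ∂μ
      ≤ 2 ^ Module.finrank ℝ X * (∫⁻ z, F z ∂μ) * μ s := by
  rw [← setLIntegral_const]
  refine lintegral_mono fun x => ?_
  refine (setLIntegral_le_lintegral _ _).trans ?_
  rw [lintegral_comp_add_smul μ hF _ (by linarith)]
  refine mul_le_mul_left ?_ _
  have h2 : |(t ^ Module.finrank ℝ X)⁻¹| ≤ 2 ^ Module.finrank ℝ X := by
    rw [← inv_pow, abs_of_nonneg (by positivity)]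
    refine pow_le_pow_left₀ (by positivity) ?_ _
    rw [inv_le_comm₀ (by linarith) (by norm_num)]
    linarith
  calc ENNReal.ofReal |(t ^ Module.finrank ℝ X)⁻¹|
      ≤ ENNReal.ofReal (2 ^ Module.finrank ℝ X) := ENNReal.ofReal_le_ofReal h2
    _ = 2 ^ Module.finrank ℝ X := by
      rw [ENNReal.ofReal_pow (by norm_num)]
      norm_num

/-- The law of `(1 - t) x + t y` for `x, y` in `s` has density at most `2 ^ dim * μ s`: change
variables in whichever of `x`, `y` carries weight at least `1 / 2`. -/
theorem setLIntegral_convexCombination_le' {F : X → ENNReal} (hF : Measurable F) (s : Set X)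
    (t : ℝ) :
    ∫⁻ x in s, ∫⁻ y in s, F ((1 - t) • x + t • y) ∂μ ∂μ
      ≤ 2 ^ Module.finrank ℝ X * (∫⁻ z, F z ∂μ) * μ s := by
  rcases le_total (1 / 2) t with ht | ht
  · exact setLIntegral_convexCombination_le μ hF s ht
  · rw [lintegral_lintegral_swap (by fun_prop)]
    have h := setLIntegral_convexCombination_le μ hF s (t := 1 - t) (by linarith)
    simpa only [sub_sub_cancel, add_comm (t • _)] using h

omit [FiniteDimensional ℝ X] [MeasurableSpace X] [BorelSpace X] in
theorem sq_sub_le_integral_segment {φ : X → ℝ} (hφ : ContDiff ℝ 1 φ) (x y : X) :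
    (φ x - φ y) ^ 2
      ≤ ‖x - y‖ ^ 2 * ∫ t in (0 : ℝ)..1, ‖fderiv ℝ φ ((1 - t) • x + t • y)‖ ^ 2 := by
  have hc : Continuous fun t : ℝ => fderiv ℝ φ ((1 - t) • x + t • y) :=
    (hφ.continuous_fderiv (by simp)).comp (by fun_prop)
  set g : ℝ → ℝ := fun t => fderiv ℝ φ ((1 - t) • x + t • y) (y - x) with hg
  have hgc : Continuous g := hc.clm_apply continuous_const
  have hd : ∀ t : ℝ, HasDerivAt (fun t : ℝ => φ ((1 - t) • x + t • y)) (g t) t := fun t => by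
    have h1 : HasDerivAt (fun t : ℝ => (1 - t) • x + t • y) (y - x) t := by
      have := (((hasDerivAt_const t (1 : ℝ)).sub (hasDerivAt_id t)).smul_const x).add
        ((hasDerivAt_id t).smul_const y)
      refine this.congr_deriv ?_
      module
    exact ((hφ.differentiable (by simp)) _).hasFDerivAt.comp_hasDerivAt t h1
  have hftc : ∫ t in (0 : ℝ)..1, g t = φ y - φ x := by
    rw [intervalIntegral.integral_eq_sub_of_hasDerivAt (fun t _ => hd t)
      (hgc.intervalIntegrable _ _)]
    simp
  set m := φ y - φ x
  -- Cauchy–Schwarz on `[0, 1]`, by expanding `∫ (g - m)² ≥ 0`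
  have hcs : m ^ 2 ≤ ∫ t in (0 : ℝ)..1, g t ^ 2 := by
    have h0 : 0 ≤ ∫ t in (0 : ℝ)..1, (g t - m) ^ 2 :=
      intervalIntegral.integral_nonneg zero_le_one fun t _ => sq_nonneg _
    have h1 : ∫ t in (0 : ℝ)..1, (g t - m) ^ 2
        = (∫ t in (0 : ℝ)..1, g t ^ 2) - 2 * m * (∫ t in (0 : ℝ)..1, g t) + m ^ 2 := by
      have : ∀ t, (g t - m) ^ 2 = g t ^ 2 - 2 * m * g t + m ^ 2 := fun t => by ring
      simp only [this]
      rw [intervalIntegral.integral_add, intervalIntegral.integral_sub,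
        intervalIntegral.integral_const_mul]
      · simp
      all_goals exact Continuous.intervalIntegrable (by fun_prop) _ _
    rw [h1, hftc] at h0
    nlinarith
  calc (φ x - φ y) ^ 2 = m ^ 2 := by ring
    _ ≤ ∫ t in (0 : ℝ)..1, g t ^ 2 := hcs
    _ ≤ ∫ t in (0 : ℝ)..1, ‖x - y‖ ^ 2 * ‖fderiv ℝ φ ((1 - t) • x + t • y)‖ ^ 2 := by
      refine intervalIntegral.integral_mono_on zero_le_one
        ((hgc.pow 2).intervalIntegrable _ _)
        ((continuous_const.mul (hc.norm.pow 2)).intervalIntegrable _ _) fun t _ => ?_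
      rw [← mul_pow, ← sq_abs, norm_sub_rev, mul_comm]
      exact pow_le_pow_left₀ (abs_nonneg (g t))
        ((fderiv ℝ φ ((1 - t) • x + t • y)).le_opNorm (y - x)) 2
    _ = _ := intervalIntegral.integral_const_mul _ _

theorem setLIntegral_setLIntegral_sq_sub_le {φ : X → ℝ} (hφ : ContDiff ℝ 1 φ) (r : ℝ) :
    ∫⁻ x in Metric.closedBall (0 : X) r, ∫⁻ y in Metric.closedBall (0 : X) r,
        ENNReal.ofReal ((φ x - φ y) ^ 2) ∂μ ∂μ
      ≤ ENNReal.ofReal ((2 * r) ^ 2) * (2 ^ Module.finrank ℝ X *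
        (∫⁻ z in Metric.closedBall (0 : X) r, ENNReal.ofReal (‖fderiv ℝ φ z‖ ^ 2) ∂μ) *
        μ (Metric.closedBall (0 : X) r)) := by
  set B : Set X := Metric.closedBall (0 : X) r
  have hBm : MeasurableSet B := Metric.isClosed_closedBall.measurableSet
  have hc : Continuous (fderiv ℝ φ) := hφ.continuous_fderiv (by simp)
  set F : X → ENNReal := B.indicator fun z => ENNReal.ofReal (‖fderiv ℝ φ z‖ ^ 2) with hF
  have hFm : Measurable F :=
    (hc.norm.pow 2).measurable.ennreal_ofReal.indicator hBm
  have hpt : ∀ x ∈ B, ∀ y ∈ B, ENNReal.ofReal ((φ x - φ y) ^ 2)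
      ≤ ENNReal.ofReal ((2 * r) ^ 2) * ∫⁻ t in Ioc (0 : ℝ) 1, F ((1 - t) • x + t • y) := by
    intro x hx y hy
    have hc' : Continuous fun t : ℝ => ‖fderiv ℝ φ ((1 - t) • x + t • y)‖ ^ 2 :=
      (hc.comp (by fun_prop)).norm.pow 2
    have hn : ‖x - y‖ ≤ 2 * r := by
      have := norm_sub_le x y
      rw [mem_closedBall_zero_iff] at hx hy
      linarith
    have h1 : ENNReal.ofReal (∫ t in (0 : ℝ)..1, ‖fderiv ℝ φ ((1 - t) • x + t • y)‖ ^ 2)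
        = ∫⁻ t in Ioc (0 : ℝ) 1, F ((1 - t) • x + t • y) := by
      rw [intervalIntegral.integral_of_le zero_le_one,
        ofReal_integral_eq_lintegral_ofReal
          ((intervalIntegrable_iff_integrableOn_Ioc_of_le zero_le_one).1
            (hc'.intervalIntegrable _ _)) (Filter.Eventually.of_forall fun t => by positivity)]
      refine setLIntegral_congr_fun measurableSet_Ioc fun t ht => ?_
      have hB : (1 - t) • x + t • y ∈ B := convex_closedBall (0 : X) r hx hy
        (by linarith [ht.2]) ht.1.le (by ring)
      simp only [hF, indicator_of_mem hB]
    rw [← h1, ← ENNReal.ofReal_mul (by positivity)]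
    refine ENNReal.ofReal_le_ofReal ((sq_sub_le_integral_segment hφ x y).trans ?_)
    refine mul_le_mul_of_nonneg_right (pow_le_pow_left₀ (norm_nonneg _) hn 2) ?_
    exact intervalIntegral.integral_nonneg zero_le_one fun t _ => by positivity
  calc _ ≤ ∫⁻ x in B, ∫⁻ y in B, ENNReal.ofReal ((2 * r) ^ 2)
        * (∫⁻ t in Ioc (0 : ℝ) 1, F ((1 - t) • x + t • y)) ∂μ ∂μ :=
      setLIntegral_mono' hBm fun x hx => setLIntegral_mono' hBm fun y hy => hpt x hx y hy
    _ = ENNReal.ofReal ((2 * r) ^ 2) * ∫⁻ x in B, ∫⁻ y in B,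
        (∫⁻ t in Ioc (0 : ℝ) 1, F ((1 - t) • x + t • y)) ∂μ ∂μ := by
      simp only [lintegral_const_mul' _ _ ENNReal.ofReal_ne_top]
    _ = ENNReal.ofReal ((2 * r) ^ 2) * ∫⁻ t in Ioc (0 : ℝ) 1, ∫⁻ x in B, ∫⁻ y in B,
        F ((1 - t) • x + t • y) ∂μ ∂μ := by
      congr 1
      have h1 : ∀ x, ∫⁻ y in B, (∫⁻ t in Ioc (0 : ℝ) 1, F ((1 - t) • x + t • y)) ∂μ
          = ∫⁻ t in Ioc (0 : ℝ) 1, ∫⁻ y in B, F ((1 - t) • x + t • y) ∂μ := fun x =>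
        lintegral_lintegral_swap (by fun_prop)
      simp only [h1]
      refine lintegral_lintegral_swap (Measurable.aemeasurable ?_)
      refine Measurable.lintegral_prod_right'
        (f := fun p : (X × ℝ) × X => F ((1 - p.1.2) • p.1.1 + p.1.2 • p.2)) ?_
      fun_prop
    _ ≤ ENNReal.ofReal ((2 * r) ^ 2) * ∫⁻ _ in Ioc (0 : ℝ) 1,
        2 ^ Module.finrank ℝ X * (∫⁻ z, F z ∂μ) * μ B := by
      gcongr with t
      exact setLIntegral_convexCombination_le' μ hFm B t
    _ = _ := by
      rw [setLIntegral_const, hF, lintegral_indicator hBm]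
      simp

/-- The Poincaré inequality on a ball, up to the choice of the subtracted constant, which is the
value of `φ` at some point of the ball. -/
theorem exists_setIntegral_sq_sub_le {r : ℝ} (hr : 0 < r) :
    ∃ K : ℝ, 0 ≤ K ∧ ∀ φ : X → ℝ, ContDiff ℝ 1 φ → ∃ m : ℝ,
      ∫ x in Metric.closedBall (0 : X) r, (φ x - m) ^ 2 ∂μ
        ≤ K * ∫ x in Metric.closedBall (0 : X) r, ‖fderiv ℝ φ x‖ ^ 2 ∂μ := by
  refine ⟨(2 * r) ^ 2 * 2 ^ Module.finrank ℝ X, by positivity, fun φ hφ => ?_⟩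
  set B : Set X := Metric.closedBall (0 : X) r
  have hBc : IsCompact B := isCompact_closedBall 0 r
  have hB0 : μ B ≠ 0 := (Metric.measure_closedBall_pos μ 0 hr).ne'
  have hBt : μ B ≠ ⊤ := hBc.measure_lt_top.ne
  have hc : Continuous (fderiv ℝ φ) := hφ.continuous_fderiv (by simp)
  have hφc : Continuous φ := hφ.continuous
  have hmeas : Measurable fun x => ∫⁻ y in B, ENNReal.ofReal ((φ x - φ y) ^ 2) ∂μ := by
    refine Measurable.lintegral_prod_right'
      (f := fun p : X × X => ENNReal.ofReal ((φ p.1 - φ p.2) ^ 2)) ?_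
    fun_prop
  -- at some point `x` the inner integral is at most its average over the ball
  obtain ⟨x, -, hx⟩ := exists_le_setLAverage hB0 hBt hmeas.aemeasurable
  refine ⟨φ x, ?_⟩
  have h2 : ∫⁻ y in B, ENNReal.ofReal ((φ x - φ y) ^ 2) ∂μ
      ≤ ENNReal.ofReal ((2 * r) ^ 2) * (2 ^ Module.finrank ℝ X *
        (∫⁻ z in B, ENNReal.ofReal (‖fderiv ℝ φ z‖ ^ 2) ∂μ)) := by
    refine hx.trans ?_
    rw [setLAverage_eq]
    refine ENNReal.div_le_of_le_mul ?_
    refine (setLIntegral_setLIntegral_sq_sub_le μ hφ r).trans (le_of_eq ?_)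
    ring
  have i1 : IntegrableOn (fun y => (φ x - φ y) ^ 2) B μ :=
    ContinuousOn.integrableOn_compact hBc (by fun_prop)
  have i2 : IntegrableOn (fun y => ‖fderiv ℝ φ y‖ ^ 2) B μ :=
    ContinuousOn.integrableOn_compact hBc (by fun_prop)
  rw [← ofReal_integral_eq_lintegral_ofReal i1 (Filter.Eventually.of_forall fun _ => sq_nonneg _),
    ← ofReal_integral_eq_lintegral_ofReal i2 (Filter.Eventually.of_forall fun _ => sq_nonneg _),
    (by norm_num : (2 : ENNReal) = ENNReal.ofReal 2), ← ENNReal.ofReal_pow (by norm_num),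
    ← ENNReal.ofReal_mul (by positivity), ← ENNReal.ofReal_mul (by positivity),
    ENNReal.ofReal_le_ofReal_iff (mul_nonneg (by positivity) (mul_nonneg (by positivity)
      (integral_nonneg fun _ => sq_nonneg _)))] at h2
  calc ∫ y in B, (φ y - φ x) ^ 2 ∂μ = ∫ y in B, (φ x - φ y) ^ 2 ∂μ := by
        simp only [sub_sq_comm]
    _ ≤ _ := h2.trans (le_of_eq (by ring))

end LocalPoincare

/-! ### Integration by parts and the Lyapunov inequality -/

section Analysis

variable {d : ℕ}

theorem norm_gradient (φ : EuclideanSpace ℝ (Fin d) → ℝ) (x : EuclideanSpace ℝ (Fin d)) :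
    ‖gradient φ x‖ = ‖fderiv ℝ φ x‖ :=
  (InnerProductSpace.toDual ℝ (EuclideanSpace ℝ (Fin d))).symm.norm_map _

theorem contDiff_fderiv_apply {φ : EuclideanSpace ℝ (Fin d) → ℝ} (hφ : ContDiff ℝ ∞ φ)
    (v : EuclideanSpace ℝ (Fin d)) : ContDiff ℝ ∞ fun x => fderiv ℝ φ x v :=
  (hφ.fderiv_right (by simp)).clm_apply contDiff_const

theorem IsTest.fderiv_apply {φ : EuclideanSpace ℝ (Fin d) → ℝ} (hφ : IsTest φ)
    (v : EuclideanSpace ℝ (Fin d)) : IsTest fun x => fderiv ℝ φ x v :=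
  ⟨contDiff_fderiv_apply hφ.1 v, hφ.2.fderiv_apply ℝ v⟩

theorem IsTest.mul_left {φ ψ : EuclideanSpace ℝ (Fin d) → ℝ} (hφ : IsTest φ)
    (hψ : ContDiff ℝ ∞ ψ) : IsTest fun x => ψ x * φ x :=
  ⟨hψ.mul hφ.1, hφ.2.mul_left⟩

theorem laplacian_eq_sum_fderiv {φ : EuclideanSpace ℝ (Fin d) → ℝ} (hφ : ContDiff ℝ ∞ φ)
    (x : EuclideanSpace ℝ (Fin d)) :
    Laplacian.laplacian φ x = ∑ i : Fin d,
      fderiv ℝ (fun y => fderiv ℝ φ y (EuclideanSpace.single i 1)) x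
        (EuclideanSpace.single i 1) := by
  rw [InnerProductSpace.laplacian_eq_iteratedFDeriv_orthonormalBasis φ
    (EuclideanSpace.basisFun (Fin d) ℝ)]
  refine Finset.sum_congr rfl fun i _ => ?_
  rw [iteratedFDeriv_two_apply, fderiv_clm_apply
    ((hφ.fderiv_right (m := ∞) (by simp)).differentiable (by simp) x)
    (differentiableAt_const _)]
  simp

theorem continuous_laplacian {φ : EuclideanSpace ℝ (Fin d) → ℝ} (hφ : ContDiff ℝ ∞ φ) :
    Continuous (Laplacian.laplacian φ) := by
  simp only [funext (laplacian_eq_sum_fderiv hφ)]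
  exact continuous_finsetSum _ fun i _ =>
    (contDiff_fderiv_apply (contDiff_fderiv_apply hφ _) _).continuous

theorem inner_gradient_gradient (φ ψ : EuclideanSpace ℝ (Fin d) → ℝ)
    (x : EuclideanSpace ℝ (Fin d)) :
    inner ℝ (gradient φ x) (gradient ψ x) = ∑ i : Fin d,
      fderiv ℝ φ x (EuclideanSpace.single i 1) * fderiv ℝ ψ x (EuclideanSpace.single i 1) := by
  simp only [PiLp.inner_apply, gradient_coord]
  exact Finset.sum_congr rfl fun i _ => mul_comm _ _

theorem integral_fderiv_eq_zero {φ : EuclideanSpace ℝ (Fin d) → ℝ} (hφ : IsTest φ)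
    (v : EuclideanSpace ℝ (Fin d)) : ∫ x, fderiv ℝ φ x v = 0 := by
  have hφ' := hφ.fderiv_apply v
  have h := integral_mul_fderiv_eq_neg_fderiv_mul_of_integrable (𝕜 := ℝ)
    (μ := (volume : Measure (EuclideanSpace ℝ (Fin d)))) (f := fun _ => (1 : ℝ)) (g := φ) (v := v)
    (by simp) (by simpa using hφ'.1.continuous.integrable_of_hasCompactSupport hφ'.2)
    (by simpa using hφ.1.continuous.integrable_of_hasCompactSupport hφ.2)
    (fun x _ => differentiableAt_const _) (fun x _ => hφ.1.differentiable (by simp) x)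
  simpa using h

variable (ρ : TargetDensity d)

theorem TargetDensity.fderiv_toFun (x v : EuclideanSpace ℝ (Fin d)) :
    fderiv ℝ ρ.toFun x v = ρ.toFun x * fderiv ℝ ρ.logDensity x v := by
  have hρ : DifferentiableAt ℝ ρ.toFun x := ρ.smooth.differentiable (by simp) x
  unfold TargetDensity.logDensity
  rw [fderiv.log hρ (ρ.pos x).ne', smul_apply, smul_eq_mul, mul_inv_cancel_left₀ (ρ.pos x).ne']

/-- The divergence theorem for the weighted divergence `∂ᵥ + ∂ᵥ log π`. -/
theorem integral_weighted_fderiv_eq_zero {φ : EuclideanSpace ℝ (Fin d) → ℝ} (hφ : IsTest φ)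
    (v : EuclideanSpace ℝ (Fin d)) :
    ∫ x, (fderiv ℝ φ x v + φ x * fderiv ℝ ρ.logDensity x v) ∂ρ.measure = 0 := by
  rw [ρ.integral_eq, ← integral_fderiv_eq_zero (hφ.mul_left ρ.smooth) v]
  congr 1
  ext x
  rw [fderiv_fun_mul (ρ.smooth.differentiable (by simp) x) (hφ.1.differentiable (by simp) x)]
  simp only [add_apply, smul_apply, smul_eq_mul, ρ.fderiv_toFun]
  ring

/-- The weight `β ((1 - β) |∇ log π|² + Δ log π) = -V⁻¹ (∇ log π · ∇V + ΔV)` of the Lyapunov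
function `V = π ^ (-β)`. -/
def TargetDensity.lyapunovWeight (β : ℝ) (x : EuclideanSpace ℝ (Fin d)) : ℝ :=
  β * ((1 - β) * ‖gradient ρ.logDensity x‖ ^ 2 + Laplacian.laplacian ρ.logDensity x)

theorem TargetDensity.continuous_lyapunovWeight (β : ℝ) : Continuous (ρ.lyapunovWeight β) := by
  have h1 := continuous_gradient ρ.smooth_log
  have h2 := continuous_laplacian ρ.smooth_log
  unfold TargetDensity.lyapunovWeight
  fun_prop

theorem hasCompactSupport_sq {f : EuclideanSpace ℝ (Fin d) → ℝ} (hf : HasCompactSupport f) :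
    HasCompactSupport fun x => f x ^ 2 := by
  simp only [sq]
  exact hf.mul_left

theorem IsTest.integrable_sq {h : EuclideanSpace ℝ (Fin d) → ℝ} (hh : IsTest h) :
    Integrable (fun x => h x ^ 2) ρ.measure :=
  Continuous.integrable_of_hasCompactSupport (hh.1.continuous.pow 2) (hasCompactSupport_sq hh.2)

theorem IsTest.integrable_sq_norm_fderiv {h : EuclideanSpace ℝ (Fin d) → ℝ} (hh : IsTest h) :
    Integrable (fun x => ‖fderiv ℝ h x‖ ^ 2) ρ.measure :=
  Continuous.integrable_of_hasCompactSupport ((hh.1.continuous_fderiv (by simp)).norm.pow 2)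
    (hasCompactSupport_sq (hh.2.fderiv ℝ).norm)

/-- The weighted divergence of `h² ∇ log π` has integral zero. -/
theorem integral_weighted_divergence_sq_mul_gradient {h : EuclideanSpace ℝ (Fin d) → ℝ}
    (hh : IsTest h) :
    ∫ x, (h x ^ 2 * (‖gradient ρ.logDensity x‖ ^ 2 + Laplacian.laplacian ρ.logDensity x)
      + 2 * h x * inner ℝ (gradient h x) (gradient ρ.logDensity x)) ∂ρ.measure = 0 := by
  have hl := ρ.smooth_log
  let g : Fin d → EuclideanSpace ℝ (Fin d) → ℝ := fun i x =>
    fderiv ℝ ρ.logDensity x (EuclideanSpace.single i 1)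
  have hg : ∀ i, ContDiff ℝ ∞ (g i) := fun i => contDiff_fderiv_apply hl _
  have hgt : ∀ i, IsTest fun x => h x * g i x * h x := fun i => hh.mul_left (hh.1.mul (hg i))
  have h1 : ∀ x, h x ^ 2 * (‖gradient ρ.logDensity x‖ ^ 2
      + Laplacian.laplacian ρ.logDensity x)
      + 2 * h x * inner ℝ (gradient h x) (gradient ρ.logDensity x)
      = ∑ i, (fderiv ℝ (fun x => h x * g i x * h x) x (EuclideanSpace.single i 1)
        + h x * g i x * h x * g i x) := by
    intro x
    rw [← real_inner_self_eq_norm_sq, inner_gradient_gradient, inner_gradient_gradient,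
      laplacian_eq_sum_fderiv hl, ← Finset.sum_add_distrib, Finset.mul_sum, Finset.mul_sum,
      ← Finset.sum_add_distrib]
    refine Finset.sum_congr rfl fun i _ => ?_
    have d1 : DifferentiableAt ℝ h x := hh.1.differentiable (by simp) x
    have d2 : DifferentiableAt ℝ (g i) x := (hg i).differentiable (by simp) x
    rw [fderiv_fun_mul (d1.fun_mul d2) d1, fderiv_fun_mul d1 d2]
    simp only [add_apply, smul_apply, smul_eq_mul, g]
    ring
  simp only [h1]
  rw [integral_finsetSum]
  · exact Finset.sum_eq_zero fun i _ => integral_weighted_fderiv_eq_zero ρ (hgt i) _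
  · intro i _
    have t1 := (hgt i).fderiv_apply (EuclideanSpace.single i 1)
    have t2 : IsTest fun x => g i x * (h x * g i x * h x) := (hgt i).mul_left (hg i)
    refine (t1.1.continuous.integrable_of_hasCompactSupport t1.2).add ?_
    simpa only [mul_comm] using t2.1.continuous.integrable_of_hasCompactSupport t2.2

/-- The Lyapunov inequality: the difference of the two sides is
`∫ |∇h + β h ∇ log π|² dπ`. -/
theorem integral_lyapunovWeight_mul_sq_le (β : ℝ) {h : EuclideanSpace ℝ (Fin d) → ℝ}
    (hh : IsTest h) :
    ∫ x, ρ.lyapunovWeight β x * h x ^ 2 ∂ρ.measure ≤ ∫ x, ‖fderiv ℝ h x‖ ^ 2 ∂ρ.measure := by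
  obtain ⟨q, hq⟩ : ∃ q : EuclideanSpace ℝ (Fin d) → ℝ, q = fun x =>
      h x ^ 2 * (‖gradient ρ.logDensity x‖ ^ 2 + Laplacian.laplacian ρ.logDensity x)
      + 2 * h x * inner ℝ (gradient h x) (gradient ρ.logDensity x) := ⟨_, rfl⟩
  have hlc := continuous_gradient ρ.smooth_log
  have hhc := continuous_gradient hh.1
  have hlap := continuous_laplacian ρ.smooth_log
  have hhc' := hh.1.continuous
  have hsq2 : HasCompactSupport fun x => h x ^ 2 := hasCompactSupport_sq hh.2
  have hsq : ∀ x, ρ.lyapunovWeight β x * h x ^ 2 ≤ ‖fderiv ℝ h x‖ ^ 2 + β * q x := by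
    intro x
    have h1 := sq_nonneg ‖gradient h x + (β * h x) • gradient ρ.logDensity x‖
    rw [norm_add_sq_real, norm_smul, mul_pow, inner_smul_right, Real.norm_eq_abs, sq_abs] at h1
    rw [TargetDensity.lyapunovWeight, hq, ← norm_gradient]
    linarith
  have i1 := hh.integrable_sq_norm_fderiv ρ
  have i2 : Integrable (fun x => ρ.lyapunovWeight β x * h x ^ 2) ρ.measure :=
    ((ρ.continuous_lyapunovWeight β).mul (hhc'.pow 2)).integrable_of_hasCompactSupport
      hsq2.mul_left
  have i3 : Integrable q ρ.measure := by
    rw [hq]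
    have c1 : Continuous fun x => h x ^ 2 * (‖gradient ρ.logDensity x‖ ^ 2
        + Laplacian.laplacian ρ.logDensity x) := (hhc'.pow 2).mul ((hlc.norm.pow 2).add hlap)
    have c2 : Continuous fun x => 2 * h x * inner ℝ (gradient h x) (gradient ρ.logDensity x) :=
      (continuous_const.mul hhc').mul (hhc.inner hlc)
    exact (c1.integrable_of_hasCompactSupport hsq2.mul_right).add
      (c2.integrable_of_hasCompactSupport hh.2.mul_left.mul_right)
  have h2 := integral_mono i2 (i1.add (i3.const_mul β)) hsq
  have h3 : ∫ x, q x ∂ρ.measure = 0 := by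
    rw [hq]
    exact integral_weighted_divergence_sq_mul_gradient ρ hh
  rw [integral_add' i1 (i3.const_mul β), integral_const_mul, h3] at h2
  linarith

/-! ### The Poincaré inequality for the target measure -/

theorem exists_cutoff (d : ℕ) : ∃ (χ : ℕ → EuclideanSpace ℝ (Fin d) → ℝ) (M : ℝ),
    (∀ n, IsTest (χ n)) ∧ (∀ n x, |χ n x| ≤ 1) ∧
    (∀ x, Filter.Tendsto (fun n => χ n x) Filter.atTop (nhds 1)) ∧
    ∀ n x, ‖fderiv ℝ (χ n) x‖ ≤ M / (n + 1) := by
  let b : ContDiffBump (0 : EuclideanSpace ℝ (Fin d)) := ⟨1, 2, one_pos, one_lt_two⟩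
  have hb : ContDiff ℝ ∞ b := b.contDiff
  obtain ⟨M, hM⟩ := (hb.continuous_fderiv (by simp)).bounded_above_of_compact_support
    (b.hasCompactSupport.fderiv ℝ)
  refine ⟨fun n x => b (((n : ℝ) + 1)⁻¹ • x), M, fun n => ⟨?_, ?_⟩, fun n x => ?_, fun x => ?_,
    fun n x => ?_⟩
  · exact hb.comp (contDiff_const_smul _)
  · exact b.hasCompactSupport.comp_smul (by positivity)
  · rw [abs_of_nonneg b.nonneg]
    exact b.le_one
  · have h1 : Filter.Tendsto (fun n : ℕ => ((n : ℝ) + 1)⁻¹ • x) Filter.atTop (nhds 0) := by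
      have := (tendsto_one_div_add_atTop_nhds_zero_nat (𝕜 := ℝ)).smul_const x
      simpa only [one_div, zero_smul] using this
    have h2 : b 0 = 1 := b.one_of_mem_closedBall (by simp [b])
    have h3 := (hb.continuous.tendsto 0).comp h1
    rwa [h2] at h3
  · have h1 : fderiv ℝ (fun x => b (((n : ℝ) + 1)⁻¹ • x)) x
        = ((n : ℝ) + 1)⁻¹ • fderiv ℝ b (((n : ℝ) + 1)⁻¹ • x) := fderiv_comp_smul _
    rw [h1, norm_smul, norm_inv, Real.norm_of_nonneg (by positivity), inv_mul_eq_div]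
    gcongr
    exact hM _

/-- An inequality `θ ∫ h² ≤ ∫ |∇h|² + k ∫_B h²` for test functions extends to
`h = φ - m`, by cutting off. -/
theorem weak_poincare_sub_const {θ k : ℝ} {B : Set (EuclideanSpace ℝ (Fin d))}
    (H : ∀ h : EuclideanSpace ℝ (Fin d) → ℝ, IsTest h →
      θ * ∫ x, h x ^ 2 ∂ρ.measure
        ≤ ∫ x, ‖fderiv ℝ h x‖ ^ 2 ∂ρ.measure + k * ∫ x in B, h x ^ 2 ∂ρ.measure)
    {φ : EuclideanSpace ℝ (Fin d) → ℝ} (hφ : IsTest φ) (m : ℝ) :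
    θ * ∫ x, (φ x - m) ^ 2 ∂ρ.measure
      ≤ ∫ x, ‖fderiv ℝ φ x‖ ^ 2 ∂ρ.measure + k * ∫ x in B, (φ x - m) ^ 2 ∂ρ.measure := by
  obtain ⟨χ, M, hχ, hχ1, hχl, hχd⟩ := exists_cutoff d
  obtain ⟨C0, hC0⟩ := hφ.1.continuous.bounded_above_of_compact_support hφ.2
  obtain ⟨C1, hC1⟩ := (hφ.1.continuous_fderiv (by simp)).bounded_above_of_compact_support
    (hφ.2.fderiv ℝ)
  set h : EuclideanSpace ℝ (Fin d) → ℝ := fun x => φ x - m with hh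
  have hhs : ContDiff ℝ ∞ h := hφ.1.sub contDiff_const
  have hhC : ∀ x, |h x| ≤ C0 + |m| := fun x =>
    (abs_sub _ _).trans (add_le_add_left (hC0 x) _)
  have hfh : ∀ x, fderiv ℝ h x = fderiv ℝ φ x := fun x => fderiv_sub_const m
  have hM0 : 0 ≤ M := by simpa using (norm_nonneg _).trans (hχd 0 0)
  have ht : ∀ n, IsTest fun x => h x * χ n x := fun n => (hχ n).mul_left hhs
  have hfd : ∀ n x, fderiv ℝ (fun x => h x * χ n x) x
      = h x • fderiv ℝ (χ n) x + χ n x • fderiv ℝ φ x := fun n x => by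
    rw [fderiv_fun_mul (hhs.differentiable (by simp) x) ((hχ n).1.differentiable (by simp) x),
      hfh]
  have hsq : ∀ n x, ‖(h x * χ n x) ^ 2‖ ≤ (C0 + |m|) ^ 2 := fun n x => by
    rw [norm_pow, norm_mul, Real.norm_eq_abs, Real.norm_eq_abs]
    refine pow_le_pow_left₀ (by positivity) ?_ 2
    exact (mul_le_of_le_one_right (abs_nonneg _) (hχ1 n x)).trans (hhC x)
  have hlim : ∀ x, Filter.Tendsto (fun n => (h x * χ n x) ^ 2) Filter.atTop
      (nhds (h x ^ 2)) := fun x => by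
    simpa using ((hχl x).const_mul (h x)).pow 2
  have l1 : Filter.Tendsto (fun n => ∫ x, (h x * χ n x) ^ 2 ∂ρ.measure) Filter.atTop
      (nhds (∫ x, h x ^ 2 ∂ρ.measure)) :=
    tendsto_integral_of_dominated_convergence (fun _ => (C0 + |m|) ^ 2)
      (fun n => ((ht n).1.continuous.pow 2).aestronglyMeasurable) (integrable_const _)
      (fun n => Filter.Eventually.of_forall (hsq n)) (Filter.Eventually.of_forall hlim)
  have l2 : Filter.Tendsto (fun n => ∫ x in B, (h x * χ n x) ^ 2 ∂ρ.measure) Filter.atTop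
      (nhds (∫ x in B, h x ^ 2 ∂ρ.measure)) :=
    tendsto_integral_of_dominated_convergence (fun _ => (C0 + |m|) ^ 2)
      (fun n => ((ht n).1.continuous.pow 2).aestronglyMeasurable) (integrable_const _)
      (fun n => Filter.Eventually.of_forall (hsq n)) (Filter.Eventually.of_forall hlim)
  have l3 : Filter.Tendsto (fun n => ∫ x, ‖fderiv ℝ (fun x => h x * χ n x) x‖ ^ 2 ∂ρ.measure)
      Filter.atTop (nhds (∫ x, ‖fderiv ℝ φ x‖ ^ 2 ∂ρ.measure)) := by
    refine tendsto_integral_of_dominated_convergence (fun _ => ((C0 + |m|) * M + C1) ^ 2)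
      (fun n => (((ht n).1.continuous_fderiv (by simp)).norm.pow 2).aestronglyMeasurable)
      (integrable_const _)
      (fun n => Filter.Eventually.of_forall fun x => ?_)
      (Filter.Eventually.of_forall fun x => ?_)
    · rw [hfd, norm_pow, norm_norm]
      refine pow_le_pow_left₀ (norm_nonneg _) ((norm_add_le _ _).trans ?_) 2
      rw [norm_smul, norm_smul, Real.norm_eq_abs, Real.norm_eq_abs]
      refine add_le_add (mul_le_mul (hhC x) ((hχd n x).trans ?_) (norm_nonneg _)
        ((abs_nonneg _).trans (hhC x))) ?_
      · exact div_le_self hM0 (by linarith [(Nat.cast_nonneg n : (0 : ℝ) ≤ n)])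
      · exact (mul_le_of_le_one_left (norm_nonneg _) (hχ1 n x)).trans (hC1 x)
    · have h0 : Filter.Tendsto (fun n => fderiv ℝ (χ n) x) Filter.atTop (nhds 0) := by
        refine squeeze_zero_norm (fun n => hχd n x) ?_
        have := (tendsto_one_div_add_atTop_nhds_zero_nat (𝕜 := ℝ)).const_mul M
        simpa only [mul_one_div, mul_zero] using this
      simp only [hfd]
      have := (((h0.const_smul (h x)).add ((hχl x).smul_const (fderiv ℝ φ x))).norm).pow 2
      simpa using this
  exact le_of_tendsto_of_tendsto' (l1.const_mul θ) (l3.add (l2.const_mul k)) fun n => H _ (ht n)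

theorem TargetDensity.DriftCondition.exists_lyapunovWeight_ge (hρ : ρ.DriftCondition) :
    ∃ β θ r : ℝ, 0 < θ ∧ 0 < r ∧
      ∀ x ∉ Metric.closedBall (0 : EuclideanSpace ℝ (Fin d)) r, θ ≤ ρ.lyapunovWeight β x := by
  obtain ⟨-, β, hβ, -, h⟩ := hρ
  obtain ⟨θ, h1, h2⟩ := EReal.lt_iff_exists_real_btwn.1 h
  have h3 := Filter.eventually_lt_of_lt_liminf h2
  obtain ⟨r, hr⟩ := Metric.closedBall_compl_subset_of_mem_cocompact h3 0
  refine ⟨β, β * θ, max r 1, mul_pos hβ (by exact_mod_cast h1), by positivity, fun x hx => ?_⟩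
  have h4 := hr fun hx' => hx (Metric.closedBall_subset_closedBall (le_max_left r 1) hx')
  exact mul_le_mul_of_nonneg_left (EReal.coe_lt_coe_iff.1 h4).le hβ.le

/-- The Poincaré inequality on a ball for `π`, by comparison with Lebesgue measure. -/
theorem exists_setIntegral_measure_sq_sub_le {r : ℝ} (hr : 0 < r) :
    ∃ K : ℝ, 0 ≤ K ∧ ∀ φ : EuclideanSpace ℝ (Fin d) → ℝ, IsTest φ → ∃ m : ℝ,
      ∫ x in Metric.closedBall 0 r, (φ x - m) ^ 2 ∂ρ.measure
        ≤ K * ∫ x, ‖fderiv ℝ φ x‖ ^ 2 ∂ρ.measure := by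
  obtain ⟨K, hK, hKφ⟩ := exists_setIntegral_sq_sub_le
    (volume : Measure (EuclideanSpace ℝ (Fin d))) hr
  have hBc : IsCompact (Metric.closedBall (0 : EuclideanSpace ℝ (Fin d)) r) :=
    isCompact_closedBall 0 r
  have hBn : (Metric.closedBall (0 : EuclideanSpace ℝ (Fin d)) r).Nonempty := ⟨0, by simp [hr.le]⟩
  generalize Metric.closedBall (0 : EuclideanSpace ℝ (Fin d)) r = B at *
  have hBm : MeasurableSet B := hBc.measurableSet
  have hρc := ρ.smooth.continuous
  obtain ⟨x2, -, h2⟩ := hBc.exists_isMinOn hBn hρc.continuousOn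
  obtain ⟨x3, -, h3⟩ := hBc.exists_isMaxOn hBn hρc.continuousOn
  rw [isMinOn_iff] at h2
  rw [isMaxOn_iff] at h3
  have hc1 := ρ.pos x2
  have hc2 := ρ.pos x3
  -- comparison of `π` with Lebesgue measure on the ball
  have hset : ∀ g : EuclideanSpace ℝ (Fin d) → ℝ,
      ∫ x in B, g x ∂ρ.measure = ∫ x in B, ρ.toFun x * g x := fun g => by
    rw [← integral_indicator hBm, ← integral_indicator hBm, ρ.integral_eq]
    congr 1
    ext x
    by_cases hx : x ∈ B <;> simp [hx]
  refine ⟨ρ.toFun x3 * K / ρ.toFun x2, by positivity, fun φ hφ => ?_⟩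
  obtain ⟨m, hm⟩ := hKφ φ (hφ.1.of_le (by simp))
  refine ⟨m, ?_⟩
  have c1 : Continuous fun x => (φ x - m) ^ 2 := (hφ.1.continuous.sub continuous_const).pow 2
  have c2 : Continuous fun x => ‖fderiv ℝ φ x‖ ^ 2 :=
    (hφ.1.continuous_fderiv (by simp)).norm.pow 2
  have iB : ∀ g : EuclideanSpace ℝ (Fin d) → ℝ, Continuous g → IntegrableOn g B volume :=
    fun g hg => hg.continuousOn.integrableOn_compact hBc
  have h7 : ∫ x in B, (φ x - m) ^ 2 ∂ρ.measure
      ≤ ρ.toFun x3 * ∫ x in B, (φ x - m) ^ 2 := by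
    rw [hset, ← integral_const_mul]
    exact setIntegral_mono_on (iB _ (hρc.mul c1)) (iB _ (continuous_const.mul c1)) hBm
      fun x hx => mul_le_mul_of_nonneg_right (h3 x hx) (sq_nonneg _)
  have h8 : ρ.toFun x2 * ∫ x in B, ‖fderiv ℝ φ x‖ ^ 2
      ≤ ∫ x in B, ‖fderiv ℝ φ x‖ ^ 2 ∂ρ.measure := by
    rw [hset, ← integral_const_mul]
    exact setIntegral_mono_on (iB _ (continuous_const.mul c2)) (iB _ (hρc.mul c2)) hBm
      fun x hx => mul_le_mul_of_nonneg_right (h2 x hx) (sq_nonneg _)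
  have h9 : ∫ x in B, ‖fderiv ℝ φ x‖ ^ 2 ∂ρ.measure ≤ ∫ x, ‖fderiv ℝ φ x‖ ^ 2 ∂ρ.measure :=
    setIntegral_le_integral (hφ.integrable_sq_norm_fderiv ρ)
      (Filter.Eventually.of_forall fun x => sq_nonneg _)
  calc _ ≤ ρ.toFun x3 * (K * ∫ x in B, ‖fderiv ℝ φ x‖ ^ 2) :=
        h7.trans (mul_le_mul_of_nonneg_left hm hc2.le)
    _ = ρ.toFun x3 * K / ρ.toFun x2 * (ρ.toFun x2 * ∫ x in B, ‖fderiv ℝ φ x‖ ^ 2) := by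
      field_simp
    _ ≤ _ := mul_le_mul_of_nonneg_left (h8.trans h9) (by positivity)

/-- The Poincaré inequality: the Lyapunov inequality controls `h²` outside a ball, the Poincaré
inequality on the ball the rest. -/
theorem exists_integral_sq_sub_le (hρ : ρ.DriftCondition) :
    ∃ C : ℝ, 0 ≤ C ∧ ∀ φ : EuclideanSpace ℝ (Fin d) → ℝ, IsTest φ → ∃ m : ℝ,
      ∫ x, (φ x - m) ^ 2 ∂ρ.measure ≤ C * ∫ x, ‖fderiv ℝ φ x‖ ^ 2 ∂ρ.measure := by
  obtain ⟨β, θ, r, hθ, hr, hw⟩ := hρ.exists_lyapunovWeight_ge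
  obtain ⟨K, hK, hKφ⟩ := exists_setIntegral_measure_sq_sub_le ρ hr
  have hBc : IsCompact (Metric.closedBall (0 : EuclideanSpace ℝ (Fin d)) r) :=
    isCompact_closedBall 0 r
  have hBn : (Metric.closedBall (0 : EuclideanSpace ℝ (Fin d)) r).Nonempty := ⟨0, by simp [hr.le]⟩
  generalize Metric.closedBall (0 : EuclideanSpace ℝ (Fin d)) r = B at *
  have hBm : MeasurableSet B := hBc.measurableSet
  have hwc := ρ.continuous_lyapunovWeight β
  obtain ⟨x1, -, h1⟩ := hBc.exists_isMinOn hBn hwc.continuousOn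
  rw [isMinOn_iff] at h1
  obtain ⟨k, hk⟩ : ∃ k, k = |ρ.lyapunovWeight β x1| + θ := ⟨_, rfl⟩
  have hk0 : 0 ≤ k := by rw [hk]; positivity
  have H : ∀ h : EuclideanSpace ℝ (Fin d) → ℝ, IsTest h →
      θ * ∫ x, h x ^ 2 ∂ρ.measure
        ≤ ∫ x, ‖fderiv ℝ h x‖ ^ 2 ∂ρ.measure + k * ∫ x in B, h x ^ 2 ∂ρ.measure := by
    intro h hh
    have i1 := hh.integrable_sq ρ
    have i2 : Integrable (fun x => ρ.lyapunovWeight β x * h x ^ 2) ρ.measure :=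
      (hwc.mul (hh.1.continuous.pow 2)).integrable_of_hasCompactSupport
        (hasCompactSupport_sq hh.2).mul_left
    have i3 : Integrable (B.indicator fun x => h x ^ 2) ρ.measure := i1.indicator hBm
    have h4 := integral_lyapunovWeight_mul_sq_le ρ β hh
    have h5 : ∫ x, θ * h x ^ 2 ∂ρ.measure ≤ ∫ x, (ρ.lyapunovWeight β x * h x ^ 2
        + k * B.indicator (fun x => h x ^ 2) x) ∂ρ.measure := by
      refine integral_mono (i1.const_mul θ) (i2.add (i3.const_mul k)) fun x => ?_
      by_cases hx : x ∈ B
      · simp only [Set.indicator_of_mem hx]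
        have h6 : θ ≤ ρ.lyapunovWeight β x + k := by
          linarith [h1 x hx, neg_abs_le (ρ.lyapunovWeight β x1)]
        rw [← add_mul]
        exact mul_le_mul_of_nonneg_right h6 (sq_nonneg _)
      · simp only [Set.indicator_of_notMem hx, mul_zero, add_zero]
        exact mul_le_mul_of_nonneg_right (hw x hx) (sq_nonneg _)
    rw [integral_const_mul, integral_add i2 (i3.const_mul k), integral_const_mul,
      integral_indicator hBm] at h5
    linarith
  refine ⟨(1 + k * K) / θ, by positivity, fun φ hφ => ?_⟩
  obtain ⟨m, hm⟩ := hKφ φ hφ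
  refine ⟨m, ?_⟩
  have h6 := weak_poincare_sub_const ρ H hφ m
  have h7 := mul_le_mul_of_nonneg_left hm hk0
  rw [div_mul_eq_mul_div, le_div_iff₀ hθ]
  linarith

end Analysis

section Operators

variable {d : ℕ} (ρ : TargetDensity d)

/-! ### The closed gradient -/

theorem graph_grad : (grad ρ).graph = gradGraph ρ :=
  Submodule.toLinearPMap_graph_eq _ (gradGraph_functional ρ)

theorem graph_symmetricGenerator : (symmetricGenerator ρ).graph = generatorGraph ρ :=
  Submodule.toLinearPMap_graph_eq _ (generatorGraph_functional ρ)

theorem graph_advection (γ : EuclideanSpace ℝ (Fin d) → EuclideanSpace ℝ (Fin d)) :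
    (advection ρ γ).graph = advectionGraph ρ γ :=
  Submodule.toLinearPMap_graph_eq _ (advectionGraph_functional ρ γ)

theorem mem_H1_iff {u : L20 ρ} : u ∈ H1 ρ ↔ ∃ w, (u, w) ∈ gradGraph ρ := by
  rw [← graph_grad]
  exact LinearPMap.mem_domain_iff

theorem mem_of_mem_gradGraph {T : Set (L20 ρ × Lp (EuclideanSpace ℝ (Fin d)) 2 ρ.measure)}
    (h : ∀ q ∈ testGradGraph ρ, q ∈ T) (hT : IsClosed T)
    {p : L20 ρ × Lp (EuclideanSpace ℝ (Fin d)) 2 ρ.measure} (hp : p ∈ gradGraph ρ) : p ∈ T :=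
  closure_minimal h hT hp

theorem norm_sq_eq_integral {F : Type*} [NormedAddCommGroup F] [InnerProductSpace ℝ F]
    {μ : Measure (EuclideanSpace ℝ (Fin d))} (w : Lp F 2 μ) :
    ‖w‖ ^ 2 = ∫ x, ‖w x‖ ^ 2 ∂μ := by
  rw [← real_inner_self_eq_norm_sq, L2.inner_def]
  simp only [real_inner_self_eq_norm_sq]

theorem IsTest.integrable {φ : EuclideanSpace ℝ (Fin d) → ℝ} (hφ : IsTest φ) :
    Integrable φ ρ.measure :=
  hφ.1.continuous.integrable_of_hasCompactSupport hφ.2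

theorem IsTest.exists_mem_testGradGraph {φ : EuclideanSpace ℝ (Fin d) → ℝ} (hφ : IsTest φ) :
    ∃ (u : L20 ρ) (w : Lp (EuclideanSpace ℝ (Fin d)) 2 ρ.measure), (u, w) ∈ testGradGraph ρ ∧
      ((u : Lp ℝ 2 ρ.measure) =ᵐ[ρ.measure] fun x => φ x - ∫ y, φ y ∂ρ.measure) ∧
      w =ᵐ[ρ.measure] fun x => gradient φ x := by
  have h1 : MemLp (fun x => φ x - ∫ y, φ y ∂ρ.measure) 2 ρ.measure :=
    (hφ.1.continuous.memLp_of_hasCompactSupport hφ.2).sub (memLp_const _)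
  have hsupp : HasCompactSupport (gradient φ) :=
    (hφ.2.fderiv ℝ).comp_left (map_zero (InnerProductSpace.toDual ℝ _).symm)
  have h2 : MemLp (gradient φ) 2 ρ.measure :=
    (continuous_gradient hφ.1).memLp_of_hasCompactSupport hsupp
  have h3 : h1.toLp _ ∈ L20 ρ := by
    rw [mem_L20, integral_congr_ae h1.coeFn_toLp,
      integral_sub (hφ.integrable ρ) (integrable_const _)]
    simp
  exact ⟨⟨h1.toLp _, h3⟩, h2.toLp _, ⟨φ, hφ, h1.coeFn_toLp, h2.coeFn_toLp⟩, h1.coeFn_toLp,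
    h2.coeFn_toLp⟩

/-- The Poincaré inequality on `ℋ¹`. -/
theorem exists_norm_le_mul_norm_of_mem_gradGraph (hρ : ρ.DriftCondition) :
    ∃ c : ℝ, ∀ p ∈ gradGraph ρ, ‖p.1‖ ≤ c * ‖p.2‖ := by
  obtain ⟨C, hC, h⟩ := exists_integral_sq_sub_le ρ hρ
  refine ⟨√C, fun p hp => ?_⟩
  refine mem_of_mem_gradGraph ρ
    (T := {p : L20 ρ × Lp (EuclideanSpace ℝ (Fin d)) 2 ρ.measure | ‖p.1‖ ≤ √C * ‖p.2‖})
    ?_ (isClosed_le (by fun_prop) (by fun_prop)) hp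
  rintro q ⟨φ, hφ, h1, h2⟩
  obtain ⟨m, hm⟩ := h φ hφ
  rw [Set.mem_ofPred_eq]
  refine le_of_sq_le_sq ?_ (by positivity)
  rw [mul_pow, Real.sq_sqrt hC, norm_sq_eq_integral q.2]
  have e1 : ‖q.1‖ ^ 2 = ∫ x, (φ x - ∫ y, φ y ∂ρ.measure) ^ 2 ∂ρ.measure := by
    rw [Submodule.coe_norm, norm_sq_eq_integral]
    refine integral_congr_ae ?_
    filter_upwards [h1] with x hx
    rw [hx, Real.norm_eq_abs, sq_abs]
  have e2 : ∫ x, ‖q.2 x‖ ^ 2 ∂ρ.measure = ∫ x, ‖fderiv ℝ φ x‖ ^ 2 ∂ρ.measure := by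
    refine integral_congr_ae ?_
    filter_upwards [h2] with x hx
    rw [hx, norm_gradient]
  rw [e1, e2]
  refine le_trans ?_ hm
  -- the mean minimises the mean square deviation
  set c := ∫ y, φ y ∂ρ.measure with hc
  have hi := hφ.integrable ρ
  have hi2 := hφ.integrable_sq ρ
  have hexp : ∀ a : ℝ, ∫ x, (φ x - a) ^ 2 ∂ρ.measure
      = ∫ x, φ x ^ 2 ∂ρ.measure - 2 * a * c + a ^ 2 := by
    intro a
    have : ∀ x, (φ x - a) ^ 2 = φ x ^ 2 - 2 * a * φ x + a ^ 2 := fun x => by ring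
    simp only [this]
    have hi3 : Integrable (fun x => φ x ^ 2 - 2 * a * φ x) ρ.measure := hi2.sub (hi.const_mul _)
    rw [integral_add hi3 (integrable_const _), integral_sub hi2 (hi.const_mul _),
      integral_const_mul]
    simp [hc]
  rw [hexp, hexp]
  linarith [sq_nonneg (m - c)]

theorem inner_eq_integral_of_mem_L20 {φ : EuclideanSpace ℝ (Fin d) → ℝ} (hφ : IsTest φ)
    {u : L20 ρ}
    (hu : (u : Lp ℝ 2 ρ.measure) =ᵐ[ρ.measure] fun x => φ x - ∫ y, φ y ∂ρ.measure) (h : L20 ρ) :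
    inner ℝ h u = ∫ x, (h : Lp ℝ 2 ρ.measure) x * φ x ∂ρ.measure := by
  have hm := hφ.1.continuous.memLp_of_hasCompactSupport (μ := ρ.measure) (p := 2) hφ.2
  have h0 : ∫ x, (h : Lp ℝ 2 ρ.measure) x ∂ρ.measure = 0 := h.2
  have hi : Integrable (fun x => (h : Lp ℝ 2 ρ.measure) x) ρ.measure :=
    (Lp.memLp (h : Lp ℝ 2 ρ.measure)).integrable (by norm_num)
  rw [Submodule.coe_inner, L2.inner_def]
  have : ∫ x, inner ℝ ((h : Lp ℝ 2 ρ.measure) x) ((u : Lp ℝ 2 ρ.measure) x) ∂ρ.measure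
      = ∫ x, ((h : Lp ℝ 2 ρ.measure) x * φ x
        - (∫ y, φ y ∂ρ.measure) * (h : Lp ℝ 2 ρ.measure) x) ∂ρ.measure := by
    refine integral_congr_ae ?_
    filter_upwards [hu] with x hx
    rw [hx]
    simp
    ring
  rw [this, integral_sub (integrable_mul_of_memLp ρ (Lp.memLp _) hm) (hi.const_mul _),
    integral_const_mul, h0, mul_zero, sub_zero]

theorem dense_H1 : Dense (H1 ρ : Set (L20 ρ)) := by
  rw [Submodule.dense_iff_topologicalClosure_eq_top, Submodule.topologicalClosure_eq_top_iff,
    Submodule.eq_bot_iff]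
  intro h hh
  rw [Submodule.mem_orthogonal'] at hh
  have hint : Integrable (fun x => (h : Lp ℝ 2 ρ.measure) x) ρ.measure :=
    (Lp.memLp (h : Lp ℝ 2 ρ.measure)).integrable (by norm_num)
  refine Subtype.ext (Lp.ext ?_)
  have hz := ae_eq_zero_of_integral_contDiff_smul_eq_zero hint.locallyIntegrable (by
    intro ψ h1 h2
    obtain ⟨u, w, hm, hu, -⟩ := IsTest.exists_mem_testGradGraph ρ ⟨h1, h2⟩
    simp only [smul_eq_mul, mul_comm (ψ _)]
    rw [← inner_eq_integral_of_mem_L20 ρ ⟨h1, h2⟩ hu]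
    exact hh u ((mem_H1_iff ρ).2 ⟨w, Submodule.le_topologicalClosure _ hm⟩))
  filter_upwards [hz, Lp.coeFn_zero ℝ 2 ρ.measure] with x a b
  exact a.trans b.symm

/-! ### The symmetric generator -/

/-- Integration by parts: `∫ u 𝒮φ dπ = -∫ ∇u · ∇φ dπ` for `u ∈ ℋ¹` and test functions `φ`. -/
theorem integral_mul_reversibleGenerator
    {p : L20 ρ × Lp (EuclideanSpace ℝ (Fin d)) 2 ρ.measure} (hp : p ∈ gradGraph ρ)
    {φ : EuclideanSpace ℝ (Fin d) → ℝ} (hφ : IsTest φ)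
    {w : Lp (EuclideanSpace ℝ (Fin d)) 2 ρ.measure}
    (hw : w =ᵐ[ρ.measure] fun x => gradient φ x) :
    ∫ x, (p.1 : Lp ℝ 2 ρ.measure) x * reversibleGenerator ρ φ x ∂ρ.measure
      = -inner ℝ p.2 w := by
  let g : Fin d → EuclideanSpace ℝ (Fin d) → ℝ := fun i x =>
    fderiv ℝ φ x (EuclideanSpace.single i 1)
  have hg : ∀ i, IsTest (g i) := fun i => hφ.fderiv_apply _
  have hgm : ∀ i, MemLp (g i) 2 ρ.measure := fun i =>
    (hg i).1.continuous.memLp_of_hasCompactSupport (hg i).2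
  have hpm : ∀ i, MemLp (fun x => p.2 x i) 2 ρ.measure := fun i =>
    (EuclideanSpace.proj (𝕜 := ℝ) i).comp_memLp' (Lp.memLp p.2)
  let k : Fin d → EuclideanSpace ℝ (Fin d) → ℝ := fun i x =>
    fderiv ℝ (g i) x (EuclideanSpace.single i 1)
      + g i x * fderiv ℝ ρ.logDensity x (EuclideanSpace.single i 1)
  have hk : ∀ i, MemLp (k i) 2 ρ.measure := fun i => by
    have t1 := (hg i).fderiv_apply (EuclideanSpace.single i 1)
    have t2 := (hg i).mul_left
      (contDiff_fderiv_apply ρ.smooth_log (EuclideanSpace.single i 1))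
    refine (t1.1.continuous.memLp_of_hasCompactSupport t1.2).add ?_
    simpa only [mul_comm] using t2.1.continuous.memLp_of_hasCompactSupport t2.2
  have h1 : inner ℝ p.2 w = ∑ i, ∫ x, g i x * p.2 x i ∂ρ.measure := by
    rw [L2.inner_def, ← integral_finsetSum _ fun i _ =>
      integrable_mul_of_memLp ρ (hgm i) (hpm i)]
    refine integral_congr_ae ?_
    filter_upwards [hw] with x hx
    rw [hx, PiLp.inner_apply]
    simp only [gradient_coord]
    rfl
  have h2 : ∫ x, (p.1 : Lp ℝ 2 ρ.measure) x * reversibleGenerator ρ φ x ∂ρ.measure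
      = ∑ i, ∫ x, k i x * (p.1 : Lp ℝ 2 ρ.measure) x ∂ρ.measure := by
    rw [← integral_finsetSum _ fun i _ => integrable_mul_of_memLp ρ (hk i) (Lp.memLp _)]
    congr 1
    ext x
    rw [reversibleGenerator, inner_gradient_gradient, laplacian_eq_sum_fderiv hφ.1,
      ← Finset.sum_add_distrib, Finset.mul_sum]
    refine Finset.sum_congr rfl fun i _ => ?_
    simp only [k, g]
    ring
  rw [h1, h2, ← Finset.sum_neg_distrib]
  refine Finset.sum_congr rfl fun i _ => ?_
  rw [gradGraph_weak ρ hp (hg i) i, neg_neg]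

/-- The variational form of `𝒮u = h`. -/
theorem mem_graph_symmetricGenerator_iff {u h : L20 ρ} :
    (u, h) ∈ (symmetricGenerator ρ).graph ↔
      ∃ w, (u, w) ∈ gradGraph ρ ∧ ∀ q ∈ gradGraph ρ, -inner ℝ w q.2 = inner ℝ h q.1 := by
  rw [graph_symmetricGenerator]
  constructor
  · rintro ⟨hu, hφ⟩
    obtain ⟨w, hw⟩ := (mem_H1_iff ρ).1 hu
    refine ⟨w, hw, fun q hq => ?_⟩
    refine mem_of_mem_gradGraph ρ
      (T := {q : L20 ρ × Lp (EuclideanSpace ℝ (Fin d)) 2 ρ.measure |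
        -inner ℝ w q.2 = inner ℝ h q.1}) ?_ (isClosed_eq (by fun_prop) (by fun_prop)) hq
    rintro q ⟨φ, ht, h1, h2⟩
    rw [Set.mem_ofPred_eq, inner_eq_integral_of_mem_L20 ρ ht h1 h,
      ← integral_mul_reversibleGenerator ρ hw ht h2]
    exact hφ φ ht
  · rintro ⟨w, hw, hq⟩
    refine ⟨(mem_H1_iff ρ).2 ⟨w, hw⟩, fun φ ht => ?_⟩
    obtain ⟨u', w', hm, h1, h2⟩ := ht.exists_mem_testGradGraph ρ
    rw [integral_mul_reversibleGenerator ρ hw ht h2, ← inner_eq_integral_of_mem_L20 ρ ht h1 h]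
    exact hq _ (Submodule.le_topologicalClosure _ hm)

/-! ### The advection operator -/

variable {γ : EuclideanSpace ℝ (Fin d) → EuclideanSpace ℝ (Fin d)}

theorem exists_multiplication (hγ : IsPerturbation ρ γ) :
    ∃ G : Lp (EuclideanSpace ℝ (Fin d)) 2 ρ.measure →L[ℝ] Lp ℝ 2 ρ.measure,
      ∀ w, G w =ᵐ[ρ.measure] fun x => inner ℝ (γ x) (w x) := by
  obtain ⟨C, hC⟩ := hγ.bounded
  have hb : ∀ (w : Lp (EuclideanSpace ℝ (Fin d)) 2 ρ.measure) x,
      ‖inner ℝ (γ x) (w x)‖ ≤ C * ‖w x‖ := fun w x =>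
    (norm_inner_le_norm _ _).trans (mul_le_mul_of_nonneg_right (hC x) (norm_nonneg _))
  have hm : ∀ w : Lp (EuclideanSpace ℝ (Fin d)) 2 ρ.measure,
      MemLp (fun x => inner ℝ (γ x) (w x)) 2 ρ.measure := fun w =>
    MemLp.of_le_mul (Lp.memLp w)
      (hγ.smooth.continuous.aestronglyMeasurable.inner (Lp.aestronglyMeasurable w))
      (Filter.Eventually.of_forall (hb w))
  refine ⟨LinearMap.mkContinuous ⟨⟨fun w => (hm w).toLp _, fun v w => ?_⟩, fun c w => ?_⟩ C
    fun w => ?_, fun w => (hm w).coeFn_toLp⟩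
  · refine Lp.ext ?_
    filter_upwards [(hm (v + w)).coeFn_toLp, (hm v).coeFn_toLp, (hm w).coeFn_toLp,
      Lp.coeFn_add v w, Lp.coeFn_add ((hm v).toLp _) ((hm w).toLp _)] with x a b c e f
    rw [a, f, Pi.add_apply, b, c, e, Pi.add_apply, inner_add_right]
  · refine Lp.ext ?_
    filter_upwards [(hm (c • w)).coeFn_toLp, (hm w).coeFn_toLp,
      Lp.coeFn_smul c w, Lp.coeFn_smul c ((hm w).toLp _)] with x a b e f
    simp only [RingHom.id_apply]
    rw [a, f, Pi.smul_apply, b, e, Pi.smul_apply, inner_smul_right, smul_eq_mul]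
  · refine Lp.norm_le_mul_norm_of_ae_le_mul ?_
    filter_upwards [(hm w).coeFn_toLp] with x a
    change ‖(hm w).toLp _ x‖ ≤ _
    rw [a]
    exact hb w x

/-- Integration by parts: `γ · ∇φ` has mean zero because `∇ · (γ π) = 0`. -/
theorem integral_fderiv_perturbation_eq_zero (hγ : IsPerturbation ρ γ)
    {φ : EuclideanSpace ℝ (Fin d) → ℝ} (hφ : IsTest φ) :
    ∫ x, fderiv ℝ φ x (γ x) ∂ρ.measure = 0 := by
  let g : Fin d → EuclideanSpace ℝ (Fin d) → ℝ := fun i x => γ x i * ρ.toFun x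
  have hg : ∀ i, ContDiff ℝ ∞ (g i) := fun i =>
    ((EuclideanSpace.proj (𝕜 := ℝ) i).contDiff.comp hγ.smooth).mul ρ.smooth
  have ht : ∀ i, IsTest fun x => g i x * φ x := fun i => hφ.mul_left (hg i)
  have h1 : ∀ x, ρ.toFun x * fderiv ℝ φ x (γ x)
      = ∑ i, fderiv ℝ (fun x => g i x * φ x) x (EuclideanSpace.single i 1) := by
    intro x
    have h2 : ∀ i, fderiv ℝ (fun x => g i x * φ x) x (EuclideanSpace.single i 1)
        = g i x * fderiv ℝ φ x (EuclideanSpace.single i 1)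
          + φ x * fderiv ℝ (g i) x (EuclideanSpace.single i 1) := fun i => by
      rw [fderiv_fun_mul ((hg i).differentiable (by simp) x) (hφ.1.differentiable (by simp) x)]
      simp
    have h3 : fderiv ℝ φ x (γ x) = ∑ i, γ x i * fderiv ℝ φ x (EuclideanSpace.single i 1) := by
      rw [← inner_gradient_left, PiLp.inner_apply]
      simp only [gradient_coord]
      rfl
    simp only [h2]
    rw [Finset.sum_add_distrib, ← Finset.mul_sum, hγ.div_free x, mul_zero, add_zero, h3,
      Finset.mul_sum]
    exact Finset.sum_congr rfl fun i _ => by simp only [g]; ring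
  rw [ρ.integral_eq]
  simp only [h1]
  rw [integral_finsetSum _ fun i _ =>
    ((ht i).fderiv_apply _).1.continuous.integrable_of_hasCompactSupport
      ((ht i).fderiv_apply _).2]
  exact Finset.sum_eq_zero fun i _ => integral_fderiv_eq_zero (ht i) _

variable {G : Lp (EuclideanSpace ℝ (Fin d)) 2 ρ.measure →L[ℝ] Lp ℝ 2 ρ.measure}

theorem multiplication_mem_L20 (hγ : IsPerturbation ρ γ)
    (hG : ∀ w, G w =ᵐ[ρ.measure] fun x => inner ℝ (γ x) (w x))
    {p : L20 ρ × Lp (EuclideanSpace ℝ (Fin d)) 2 ρ.measure} (hp : p ∈ gradGraph ρ) :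
    G p.2 ∈ L20 ρ := by
  -- the range of `G` on the gradients of test functions lies in the closed subspace `L²₀(π)`
  have hcl : IsClosed (L20 ρ : Set (Lp ℝ 2 ρ.measure)) :=
    (completeSpace_coe_iff_isComplete.1 (inferInstance : CompleteSpace (L20 ρ))).isClosed
  refine mem_of_mem_gradGraph ρ
    (T := (fun p : L20 ρ × Lp (EuclideanSpace ℝ (Fin d)) 2 ρ.measure => G p.2) ⁻¹'
      (L20 ρ : Set (Lp ℝ 2 ρ.measure))) ?_ (hcl.preimage (by fun_prop)) hp
  rintro q ⟨φ, hφ, -, h2⟩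
  rw [Set.mem_preimage, SetLike.mem_coe, mem_L20, ← integral_fderiv_perturbation_eq_zero ρ hγ hφ]
  refine integral_congr_ae ?_
  filter_upwards [hG q.2, h2] with x a b
  rw [a, b, real_inner_comm, inner_gradient_left]

theorem inner_multiplication_eq_neg_of_test (hγ : IsPerturbation ρ γ)
    (hG : ∀ w, G w =ᵐ[ρ.measure] fun x => inner ℝ (γ x) (w x))
    {p q : L20 ρ × Lp (EuclideanSpace ℝ (Fin d)) 2 ρ.measure} (hp : p ∈ testGradGraph ρ)
    (hq : q ∈ testGradGraph ρ) :
    inner ℝ (G p.2) (q.1 : Lp ℝ 2 ρ.measure) = -inner ℝ (p.1 : Lp ℝ 2 ρ.measure) (G q.2) := by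
  obtain ⟨φ, hφ, h1, h2⟩ := hp
  obtain ⟨ψ, hψ, h3, h4⟩ := hq
  set a := ∫ y, φ y ∂ρ.measure
  set b := ∫ y, ψ y ∂ρ.measure
  -- `(φ - a) (ψ - b)` is a constant plus a test function
  have ht : IsTest fun x => (φ x - a) * ψ x - b * φ x :=
    ⟨((hφ.1.sub contDiff_const).mul hψ.1).sub (contDiff_const.mul hφ.1),
      hψ.2.mul_left.sub hφ.2.mul_left⟩
  rw [eq_neg_iff_add_eq_zero, L2.inner_def, L2.inner_def,
    ← integral_add (L2.integrable_inner _ _) (L2.integrable_inner _ _),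
    ← integral_fderiv_perturbation_eq_zero ρ hγ ht]
  refine integral_congr_ae ?_
  filter_upwards [h1, h2, h3, h4, hG p.2, hG q.2] with x a1 a2 a3 a4 a5 a6
  have d1 : DifferentiableAt ℝ φ x := hφ.1.differentiable (by simp) x
  have d2 : DifferentiableAt ℝ ψ x := hψ.1.differentiable (by simp) x
  rw [a5, a6, a1, a2, a3, a4, real_inner_comm (gradient φ x), real_inner_comm (gradient ψ x),
    inner_gradient_left, inner_gradient_left,
    fderiv_fun_sub ((d1.sub_const a).fun_mul d2) (d1.const_mul b),
    fderiv_fun_mul (d1.sub_const a) d2, fderiv_const_mul d1, fderiv_sub_const]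
  simp
  ring

/-- `𝒜` is antisymmetric on `ℋ¹`. -/
theorem inner_multiplication_eq_neg (hγ : IsPerturbation ρ γ)
    (hG : ∀ w, G w =ᵐ[ρ.measure] fun x => inner ℝ (γ x) (w x))
    {p q : L20 ρ × Lp (EuclideanSpace ℝ (Fin d)) 2 ρ.measure} (hp : p ∈ gradGraph ρ)
    (hq : q ∈ gradGraph ρ) :
    inner ℝ (G p.2) (q.1 : Lp ℝ 2 ρ.measure) = -inner ℝ (p.1 : Lp ℝ 2 ρ.measure) (G q.2) := by
  refine mem_of_mem_gradGraph ρ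
    (T := {p : L20 ρ × Lp (EuclideanSpace ℝ (Fin d)) 2 ρ.measure |
      inner ℝ (G p.2) (q.1 : Lp ℝ 2 ρ.measure) = -inner ℝ (p.1 : Lp ℝ 2 ρ.measure) (G q.2)})
    (fun p hp => ?_) (isClosed_eq (by fun_prop) (by fun_prop)) hp
  refine mem_of_mem_gradGraph ρ
    (T := {q : L20 ρ × Lp (EuclideanSpace ℝ (Fin d)) 2 ρ.measure |
      inner ℝ (G p.2) (q.1 : Lp ℝ 2 ρ.measure) = -inner ℝ (p.1 : Lp ℝ 2 ρ.measure) (G q.2)})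
    (fun q hq => ?_) (isClosed_eq (by fun_prop) (by fun_prop)) hq
  exact inner_multiplication_eq_neg_of_test ρ hγ hG hp hq

theorem mem_graph_advection_iff (hG : ∀ w, G w =ᵐ[ρ.measure] fun x => inner ℝ (γ x) (w x))
    {u f : L20 ρ} :
    (u, f) ∈ (advection ρ γ).graph ↔ ∃ w, (u, w) ∈ gradGraph ρ ∧ G w = f := by
  rw [graph_advection]
  have hgr : ∀ hu : u ∈ H1 ρ, (u, grad ρ ⟨u, hu⟩) ∈ gradGraph ρ := fun hu => by
    rw [← graph_grad]
    exact LinearPMap.mem_graph (grad ρ) ⟨u, hu⟩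
  constructor
  · rintro ⟨hu, hf⟩
    exact ⟨_, hgr hu, Lp.ext ((hG _).trans hf.symm)⟩
  · rintro ⟨w, hw, hf⟩
    have hu := (mem_H1_iff ρ).2 ⟨w, hw⟩
    have e : grad ρ ⟨u, hu⟩ = w := by
      rw [← graph_grad] at hw
      exact LinearPMap.mem_graph_snd_inj _ (LinearPMap.mem_graph (grad ρ) ⟨u, hu⟩) hw rfl
    refine ⟨hu, ?_⟩
    change (f : Lp ℝ 2 ρ.measure) =ᵐ[ρ.measure] _
    rw [e, ← hf]
    exact hG w

theorem domain_advection (hγ : IsPerturbation ρ γ) : (advection ρ γ).domain = H1 ρ := by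
  obtain ⟨G, hG⟩ := exists_multiplication ρ hγ
  ext u
  rw [LinearPMap.mem_domain_iff, mem_H1_iff]
  simp only [mem_graph_advection_iff ρ hG]
  constructor
  · rintro ⟨f, w, hw, -⟩
    exact ⟨w, hw⟩
  · rintro ⟨w, hw⟩
    exact ⟨⟨G w, multiplication_mem_L20 ρ hγ hG hw⟩, w, hw, rfl⟩

theorem neg_advection_le_adjoint (hγ : IsPerturbation ρ γ) :
    -advection ρ γ ≤ (advection ρ γ).adjoint := by
  obtain ⟨G, hG⟩ := exists_multiplication ρ hγ
  refine LinearPMap.IsFormalAdjoint.le_adjoint (by rw [domain_advection ρ hγ]; exact dense_H1 ρ) ?_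
  intro v u
  obtain ⟨w, hw, hf⟩ := (mem_graph_advection_iff ρ hG).1 (LinearPMap.mem_graph (advection ρ γ) u)
  obtain ⟨w', hw', hf'⟩ :=
    (mem_graph_advection_iff ρ hG).1 (LinearPMap.mem_graph (advection ρ γ) v)
  have h := inner_multiplication_eq_neg ρ hγ hG hw' hw
  rw [hf, hf'] at h
  rw [LinearPMap.neg_apply, inner_neg_right]
  exact h

/-! ### Asymptotic variance -/

/-- If `-ℒ` has a bounded inverse `R`, the asymptotic variance is `2 ‖w‖²` with
`w = ∇(R f)`. -/
theorem asymptoticVariance_eq_of_isBoundedInverse {α : ℝ} {R : L20 ρ →L[ℝ] L20 ρ}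
    (hR : IsBoundedInverse (-generator ρ γ α) R) {f : L20 ρ}
    {w : Lp (EuclideanSpace ℝ (Fin d)) 2 ρ.measure} (hw : (R f, w) ∈ gradGraph ρ) :
    asymptoticVariance ρ γ α f = 2 * ‖w‖ ^ 2 := by
  have h : ∃ φ : H1 ρ, ∃ hφ : (φ : L20 ρ) ∈ (generator ρ γ α).domain,
      -(generator ρ γ α ⟨φ, hφ⟩) = f := by
    obtain ⟨hd, e⟩ := hR.2 f
    exact ⟨⟨R f, (mem_H1_iff ρ).2 ⟨w, hw⟩⟩, hd, e⟩
  rw [asymptoticVariance, dif_pos h]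
  obtain ⟨hd, e⟩ := h.choose_spec
  -- the Poisson equation has only the solution `R f`, so the choice made does not matter
  have h1 : (h.choose : L20 ρ) = R f := by
    rw [← hR.1 ⟨_, hd⟩]
    exact congrArg R e
  have h2 : grad ρ h.choose = w := by
    rw [← graph_grad] at hw
    exact LinearPMap.mem_graph_snd_inj _ (LinearPMap.mem_graph (grad ρ) h.choose) hw h1
  rw [h2, norm_sq_eq_integral]

end Operators

end NonreversibleLangevin

end

open NonreversibleLangevin
theorem mainTheorem3 {d : ℕ} (ρ : TargetDensity d)
    (hdrift : ρ.DriftCondition) (hlog : ρ.GradLogToInfinity)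
    (γ : EuclideanSpace ℝ (Fin d) → EuclideanSpace ℝ (Fin d))
    (hγ : IsPerturbation ρ γ) (α : ℝ) :
    -- `𝒜` is defined on all of `ℋ¹`, and `𝒜* = -𝒜` there
    (advection ρ γ).domain = H1 ρ ∧
    -advection ρ γ ≤ (advection ρ γ).adjoint ∧
    -- `R = (-ℒ)⁻¹` and `R₀ = (-𝒮)⁻¹`
    ∃ R R₀ : L20 ρ →L[ℝ] L20 ρ,
      IsBoundedInverse (-generator ρ γ α) R ∧
      IsBoundedInverse (-symmetricGenerator ρ) R₀ ∧
      -- `[(-ℒ)⁻¹]^S = [-𝒮 + α² 𝒜* (-𝒮)⁻¹ 𝒜]⁻¹`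
      IsBoundedInverse
        (-symmetricGenerator ρ +
          α ^ 2 • compPartial (advection ρ γ).adjoint
            (compPartial
              (-symmetricGenerator ρ).inverse
              (advection ρ γ)))
        (symmetricPart R) ∧
      ∀ f : L20 ρ,
        asymptoticVariance ρ γ α f = 2 * inner ℝ f (R f) ∧
        2 * inner ℝ f (R f) ≤ 2 * inner ℝ f (R₀ f) ∧
        2 * inner ℝ f (R₀ f) = asymptoticVariance ρ γ 0 f := by
  refine ⟨domain_advection ρ hγ, neg_advection_le_adjoint ρ hγ, ?_⟩
  obtain ⟨G, hG⟩ := exists_multiplication ρ hγ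
  obtain ⟨c, hc⟩ := exists_norm_le_mul_norm_of_mem_gradGraph ρ hdrift
  obtain ⟨W, J, hW, hJ, hJW⟩ := exists_bounded_inverse_on_range (grad ρ)
    (by rw [graph_grad]; exact Submodule.isClosed_topologicalClosure _) (c := c)
    (fun u => hc (u, grad ρ u) (by rw [← graph_grad]; exact LinearPMap.mem_graph _ u))
  rw [graph_grad] at hJW
  have hJw : ∀ w : W, (J w, (w : Lp (EuclideanSpace ℝ (Fin d)) 2 ρ.measure)) ∈ gradGraph ρ :=
    fun w => (hJW _ _).2 ⟨w.2, rfl⟩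
  have : CompleteSpace W := hW.completeSpace_coe
  let K : W →L[ℝ] L20 ρ := (G ∘L W.subtypeL).codRestrict (L20 ρ) fun w =>
    multiplication_mem_L20 ρ hγ hG (hJw w)
  have hskew : ∀ v w, inner ℝ (K v) (J w) = -inner ℝ (J v) (K w) := fun v w =>
    inner_multiplication_eq_neg ρ hγ hG (hJw v) (hJw w)
  have hA : ∀ u f, (u, f) ∈ (advection ρ γ).graph ↔ ∃ w, J w = u ∧ K w = f := by
    intro u f
    rw [mem_graph_advection_iff ρ hG]
    simp only [hJW]
    constructor
    · rintro ⟨w, ⟨hw, rfl⟩, h⟩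
      exact ⟨⟨w, hw⟩, rfl, Subtype.ext h⟩
    · rintro ⟨w, rfl, rfl⟩
      exact ⟨w, ⟨w.2, rfl⟩, rfl⟩
  -- `-𝒮 = ∇* ∇`
  have hS := isBoundedInverse_neg_of_variational hJW fun u h =>
    mem_graph_symmetricGenerator_iff ρ (u := u) (h := h)
  obtain ⟨R, R₀, hR, hR0', hR0, hsym, hf⟩ := exists_inverses_of_factorisation hJ hskew hA
    (neg_advection_le_adjoint ρ hγ) hS α
  refine ⟨R, R₀, hR, hR0, hsym, fun f => ?_⟩
  obtain ⟨w, w₀, h1, h2, h3, h4, h5⟩ := hf f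
  rw [h3, h4, asymptoticVariance_eq_of_isBoundedInverse ρ hR (h1 ▸ hJw w),
    asymptoticVariance_eq_of_isBoundedInverse ρ hR0' (h2 ▸ hJw w₀)]
  refine ⟨rfl, ?_, rfl⟩
  gcongr
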